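/- **Proposition (Lawson).** Let $G$ be a discrete group. For $n\ge 0$ let $U(n)$ be the unitary group ($U(0)$ is trivial) and let $\mathrm{Hom}(G,U(n))$ be topologized as a subspace of $\prod_{g\in G}U(n)$. Let $\mathcal{R}(G)$ be the topological category with object space $\coprod_{n\ge 0}\mathrm{Hom}(G,U(n))$ and morphism space $\coprod_{n\ge 0}U(n)\times\mathrm{Hom}(G,U(n))$, where $(A,\rho)$ is a morphism $\rho\to A\rho A^{-1}$ and $(B,A\rho A^{-1})\circ(A,\rho)=(BA,\rho)$. Let $|\mathcal{R}(G)|$ be the geometric realization of its nerve; block sum of matrices is a functor $\oplus\colon\mathcal{R}(G)\times\mathcal{R}(G)\to\mathcal{R}(G)$, and it makes $|\mathcal{R}(G)|$ a monoid whose unit is the vertex given by the $0$-dimensional representation. Let $EU(n)$ be the geometric realization of the nerve of the topological category $\overline{U(n)}$ with object space $U(n)$ and exactly one morphism between any two objects (morphism space $U(n)\times U(n)$). Let $U(n)$ act on the right on $EU(n)\times\mathrm{Hom}(G,U(n))$ by $(e,\rho)\cdot g=(eg,g^{-1}\rho g)$, where $eg$ is induced by right multiplication $A\mapsto Ag$ on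 objects of $\overline{U(n)}$, and let $EU(n)\times_{U(n)}\mathrm{Hom}(G,U(n))$ be the quotient space. Put $$\mathrm{Rep}(G)_{hU}=\coprod_{n\ge 0}EU(n)\times_{U(n)}\mathrm{Hom}(G,U(n)),$$ a monoid under $[e_1,\rho_1]\oplus[e_2,\rho_2]=[e_1\oplus e_2,\rho_1\oplus\rho_2]$, where $\oplus\colon EU(n)\times EU(m)\to EU(n+m)$ is induced by block sum of matrices; its unit is the unique point in dimension $0$. Let $\alpha\colon\mathrm{Rep}(G)_{hU}\to|\mathcal{R}(G)|$ be the (well-defined) map $$\alpha\big([A_0\to A_1\to\cdots\to A_k,\,t,\,\rho]\big)=\Big[A_0\rho A_0^{-1}\xrightarrow{A_1A_0^{-1}}A_1\rho A_1^{-1}\xrightarrow{A_2A_1^{-1}}\cdots\xrightarrow{A_kA_{k-1}^{-1}}A_k\rho A_k^{-1},\,t\Big],$$ for $A_0,\dots,A_k\in U(n)$, $t\in\Delta^k$ and $\rho\in\mathrm{Hom}(G,U(n))$. Then $\mathrm{Rep}(G)_{hU}$ and $|\mathcal{R}(G)|$ are topological monoids (their multiplications are continuous), and $\alpha$ is an isomorphism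 of topological monoids, that is, an isomorphism of monoids and a homeomorphism. -/

import Mathlib

namespace DefK

noncomputable section

open CategoryTheory Opposite

universe u w

/-! ### Geometric realization of simplicial spaces -/

/-- The disjoint union `∐ₖ Xₖ × Δᵏ`, with its sum topology. -/
abbrev Cells (X : SimplicialObject TopCat.{u}) : Type u :=
  Σ k : ℕ, X.obj (op (SimplexCategory.mk k)) × stdSimplex ℝ (Fin (k + 1))

/-- The relation `(θ^* x, t) ∼ (x, θ_* t)` on `∐ₖ Xₖ × Δᵏ`, for `θ : [k] → [l]` monotone. -/
inductive CellRel (X : SimplicialObject TopCat.{u}) : Cells X → Cells X → Prop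
  | glue {k l : ℕ} (θ : SimplexCategory.mk k ⟶ SimplexCategory.mk l)
      (x : X.obj (op (SimplexCategory.mk l))) (t : stdSimplex ℝ (Fin (k + 1))) :
      CellRel X ⟨k, X.map θ.op x, t⟩ ⟨l, x, stdSimplex.map θ.toOrderHom t⟩

/-- The geometric realization `|X|` of a simplicial space: the quotient space of `∐ₖ Xₖ × Δᵏ` by the
equivalence relation generated by `CellRel`. -/
def Realization (X : SimplicialObject TopCat.{u}) : Type u := Quot (CellRel X)

instance (X : SimplicialObject TopCat.{u}) : TopologicalSpace (Realization X) :=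
  inferInstanceAs (TopologicalSpace (Quot (CellRel X)))

/-- The class `[x, t]` in `|X|`. -/
def Realization.mk {X : SimplicialObject TopCat.{u}} {k : ℕ}
    (x : X.obj (op (SimplexCategory.mk k))) (t : stdSimplex ℝ (Fin (k + 1))) : Realization X :=
  Quot.mk _ ⟨k, x, t⟩

theorem Realization.exists_rep {X : SimplicialObject TopCat.{u}} (p : Realization X) :
    ∃ (k : ℕ) (x : X.obj (op (SimplexCategory.mk k))) (t : stdSimplex ℝ (Fin (k + 1))),
      p = Realization.mk x t := by
  obtain ⟨⟨k, x, t⟩, rfl⟩ := Quot.exists_rep p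
  exact ⟨k, x, t, rfl⟩

theorem Realization.glue {X : SimplicialObject TopCat.{u}} {k l : ℕ}
    (θ : SimplexCategory.mk k ⟶ SimplexCategory.mk l)
    (x : X.obj (op (SimplexCategory.mk l))) (t : stdSimplex ℝ (Fin (k + 1))) :
    Realization.mk x (stdSimplex.map θ.toOrderHom t) = Realization.mk (X.map θ.op x) t :=
  (Quot.sound (CellRel.glue θ x t)).symm

/-- The map `|X| → |Y|` induced by a levelwise map commuting with the simplicial operators. -/
def Realization.map {X : SimplicialObject TopCat.{u}} {Y : SimplicialObject TopCat.{w}}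
    (f : ∀ k : ℕ, X.obj (op (SimplexCategory.mk k)) → Y.obj (op (SimplexCategory.mk k)))
    (hf : ∀ {k l : ℕ} (θ : SimplexCategory.mk k ⟶ SimplexCategory.mk l)
      (x : X.obj (op (SimplexCategory.mk l))), f k (X.map θ.op x) = Y.map θ.op (f l x)) :
    Realization X → Realization Y :=
  Quot.map (fun p => ⟨p.1, f _ p.2.1, p.2.2⟩) (by
    rintro _ _ ⟨θ, x, t⟩
    dsimp only
    rw [hf]
    exact CellRel.glue θ _ t)

/-! ### Points of simplices as step functions, and realization of products -/

/-- The partial sums `t₀ + ⋯ + tᵢ` of the barycentric coordinates. -/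
def partialSum {k : ℕ} (t : stdSimplex ℝ (Fin (k + 1))) (i : Fin (k + 1)) : ℝ :=
  ∑ j ∈ Finset.Iic i, t j

theorem partialSum_nonneg {k : ℕ} (t : stdSimplex ℝ (Fin (k + 1))) (i : Fin (k + 1)) :
    0 ≤ partialSum t i :=
  Finset.sum_nonneg fun j _ => t.2.1 j

theorem partialSum_le_one {k : ℕ} (t : stdSimplex ℝ (Fin (k + 1))) (i : Fin (k + 1)) :
    partialSum t i ≤ 1 := by
  rw [← t.2.2]
  exact Finset.sum_le_sum_of_subset_of_nonneg (Finset.subset_univ _) fun j _ _ => t.2.1 j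

theorem partialSum_mono {k : ℕ} (t : stdSimplex ℝ (Fin (k + 1))) : Monotone (partialSum t) :=
  fun _ _ h => Finset.sum_le_sum_of_subset_of_nonneg (Finset.Iic_subset_Iic.2 h)
    fun j _ _ => t.2.1 j

theorem partialSum_last {k : ℕ} (t : stdSimplex ℝ (Fin (k + 1))) :
    partialSum t (Fin.last k) = 1 := by
  rw [← t.2.2]
  refine Finset.sum_congr ?_ fun _ _ => rfl
  ext j
  simp [Fin.le_last]

theorem partialSum_injective {k : ℕ} {s t : stdSimplex ℝ (Fin (k + 1))}
    (h : ∀ i, partialSum s i = partialSum t i) : s = t := by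
  ext i
  induction i using WellFoundedLT.induction with
  | ind i ih =>
    have h1 := h i
    unfold partialSum at h1
    rw [← Finset.Iio_insert, Finset.sum_insert (by simp), Finset.sum_insert (by simp),
      Finset.sum_congr rfl fun j hj => ih j (Finset.mem_Iio.1 hj)] at h1
    linarith

theorem partialSum_map {k l : ℕ} (f : Fin (k + 1) → Fin (l + 1)) (t : stdSimplex ℝ (Fin (k + 1)))
    (j : Fin (l + 1)) :
    partialSum (stdSimplex.map f t) j = ∑ i with f i ≤ j, t i := by
  classical
  unfold partialSum
  simp only [stdSimplex.map_coe, FunOnFinite.linearMap_apply_apply]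
  rw [← Finset.sum_fiberwise_of_maps_to (s := {i | f i ≤ j}) (t := Finset.Iic j) (g := f)
    (by simp)]
  refine Finset.sum_congr rfl fun y hy => Finset.sum_congr ?_ fun _ _ => rfl
  ext i
  simp only [Finset.mem_filter, Finset.mem_univ, true_and, Finset.mem_Iic] at hy ⊢
  constructor
  · rintro rfl
    exact ⟨hy, rfl⟩
  · exact fun h => h.2

theorem exists_step {k : ℕ} (t : stdSimplex ℝ (Fin (k + 1))) (a : Set.Ico (0 : ℝ) 1) :
    ∃ i : Fin (k + 1), ∀ j, i ≤ j ↔ (a : ℝ) < partialSum t j := by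
  classical
  have hne : (Finset.univ.filter fun j => (a : ℝ) < partialSum t j).Nonempty :=
    ⟨Fin.last k, by simpa [partialSum_last] using a.2.2⟩
  refine ⟨Finset.min' _ hne, fun j => ⟨fun h => ?_, fun h => Finset.min'_le _ _ (by simpa using h)⟩⟩
  have h1 := Finset.min'_mem _ hne
  simp only [Finset.mem_filter, Finset.mem_univ, true_and] at h1
  exact h1.trans_le (partialSum_mono t h)

/-- A point `t ∈ Δᵏ` viewed as the monotone step function `[0, 1) → [k]` that takes the value `i` on
an interval of length `tᵢ`. -/
def step {k : ℕ} (t : stdSimplex ℝ (Fin (k + 1))) (a : Set.Ico (0 : ℝ) 1) : Fin (k + 1) :=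
  (exists_step t a).choose

theorem step_le_iff {k : ℕ} (t : stdSimplex ℝ (Fin (k + 1))) (a : Set.Ico (0 : ℝ) 1)
    (j : Fin (k + 1)) : step t a ≤ j ↔ (a : ℝ) < partialSum t j :=
  (exists_step t a).choose_spec j

theorem step_mono {k : ℕ} (t : stdSimplex ℝ (Fin (k + 1))) : Monotone (step t) := by
  intro a b h
  rw [step_le_iff]
  exact lt_of_le_of_lt h ((step_le_iff t b _).1 le_rfl)

theorem step_map {k l : ℕ} (f : Fin (k + 1) →o Fin (l + 1)) (t : stdSimplex ℝ (Fin (k + 1)))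
    (a : Set.Ico (0 : ℝ) 1) : step (stdSimplex.map f t) a = f (step t a) := by
  classical
  refine eq_of_forall_ge_iff fun j => ?_
  rw [step_le_iff, partialSum_map]
  by_cases hne : (Finset.univ.filter fun i => f i ≤ j).Nonempty
  · have hm := Finset.max'_mem _ hne
    set m := Finset.max' _ hne with hmdef
    simp only [Finset.mem_filter, Finset.mem_univ, true_and] at hm
    have key : ∀ i, f i ≤ j ↔ i ≤ m := fun i =>
      ⟨fun h => Finset.le_max' _ _ (by simpa using h), fun h => (f.monotone h).trans hm⟩
    rw [key, step_le_iff, partialSum]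
    have : (Finset.univ.filter fun i => f i ≤ j) = Finset.Iic m := by
      ext i; simp [key]
    rw [this]
  · rw [Finset.not_nonempty_iff_eq_empty] at hne
    rw [hne, Finset.sum_empty]
    refine ⟨fun h => absurd h (not_lt.2 a.2.1), fun h => ?_⟩
    have : step t a ∈ (Finset.univ.filter fun i => f i ≤ j) := by simpa using h
    rw [hne] at this
    simp at this

/-- Sampling the step function of `t` along a monotone family of points of `[0, 1)`. -/
def sampleHom {k r : ℕ} (t : stdSimplex ℝ (Fin (k + 1))) (c : Fin (r + 1) →o Set.Ico (0 : ℝ) 1) :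
    SimplexCategory.mk r ⟶ SimplexCategory.mk k :=
  SimplexCategory.mkHom ⟨fun i => step t (c i), (step_mono t).comp c.monotone⟩

/-- Sampling a point of `|X|` along a monotone family of points of `[0, 1)`. -/
def sample {X : SimplicialObject TopCat.{u}} {r : ℕ} (c : Fin (r + 1) →o Set.Ico (0 : ℝ) 1) :
    Realization X → X.obj (op (SimplexCategory.mk r)) :=
  Quot.lift (fun p => X.map (sampleHom p.2.2 c).op p.2.1) (by
    rintro _ _ ⟨θ, x, t⟩
    have h : sampleHom (stdSimplex.map θ.toOrderHom t) c = sampleHom t c ≫ θ := by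
      ext i : 3
      exact step_map θ.toOrderHom t (c i)
    simp only [h, op_comp, Functor.map_comp]
    rfl)

theorem exists_common {k l : ℕ} (s : stdSimplex ℝ (Fin (k + 1))) (t : stdSimplex ℝ (Fin (l + 1))) :
    ∃ (r : ℕ) (c : Fin (r + 1) →o Set.Ico (0 : ℝ) 1) (v : stdSimplex ℝ (Fin (r + 1))),
      stdSimplex.map (sampleHom s c).toOrderHom v = s ∧
      stdSimplex.map (sampleHom t c).toOrderHom v = t := by
  classical
  let F : Finset ℝ := ({0} ∪ Finset.univ.image (partialSum s) ∪
    Finset.univ.image (partialSum t)).filter (· < 1)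
  have h0 : (0 : ℝ) ∈ F := by simp [F]
  have hF : ∀ a ∈ F, 0 ≤ a ∧ a < 1 := by
    intro a ha
    simp only [F, Finset.mem_filter, Finset.mem_union, Finset.mem_image, Finset.mem_singleton,
      Finset.mem_univ, true_and] at ha
    refine ⟨?_, ha.2⟩
    rcases ha.1 with (rfl | ⟨i, rfl⟩) | ⟨i, rfl⟩
    · exact le_rfl
    · exact partialSum_nonneg _ _
    · exact partialSum_nonneg _ _
  obtain ⟨r, hr⟩ : ∃ r, F.card = r + 1 :=
    Nat.exists_eq_succ_of_ne_zero (Finset.card_ne_zero_of_mem h0)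
  let e := F.orderEmbOfFin hr
  have he : ∀ i, e i ∈ F := Finset.orderEmbOfFin_mem F hr
  let c : Fin (r + 1) →o Set.Ico (0 : ℝ) 1 :=
    ⟨fun i => ⟨e i, hF _ (he i)⟩, fun i j h => e.monotone h⟩
  let d : ℕ → ℝ := fun i => if h : i < r + 1 then e ⟨i, h⟩ else 1
  have hd : ∀ i : Fin (r + 1), d i = e i := fun i => by
    simp only [d, dif_pos i.2]
  have hd0 : d 0 = 0 := by
    obtain ⟨i, hi⟩ : ∃ i, e i = 0 := by
      have := Finset.range_orderEmbOfFin F hr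
      have h2 : (0 : ℝ) ∈ Set.range (F.orderEmbOfFin hr) := by rw [this]; exact h0
      exact h2
    have h1 : e 0 ≤ e i := e.monotone (Fin.zero_le i)
    have h2 := (hF _ (he 0)).1
    have h3 : d 0 = e 0 := hd 0
    linarith
  have hd1 : d (r + 1) = 1 := by simp [d]
  have hdlt : ∀ i j, i < j → j ≤ r + 1 → d i < d j := by
    intro i j hij hj
    have hi : i < r + 1 := by omega
    rcases Nat.lt_or_ge j (r + 1) with h | h
    · simp only [d, hi, h, dif_pos]
      exact e.strictMono hij
    · simp only [d, hi, dif_pos, dif_neg (not_lt.2 h)]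
      exact (hF _ (he _)).2
  have hsum : ∀ m, m ≤ r + 1 →
      ∑ i : Fin (r + 1) with e i < d m, (d (i + 1) - d i) = d m := by
    intro m hm
    have h1 : ∀ i : Fin (r + 1), e i < d m ↔ (i : ℕ) < m := by
      intro i
      rw [← hd i]
      refine ⟨fun h => ?_, fun h => hdlt _ _ h hm⟩
      by_contra hmi
      rcases (not_lt.1 hmi).eq_or_lt with h2 | h2
      · rw [h2] at h; exact lt_irrefl _ h
      · exact lt_asymm h (hdlt _ _ h2 i.2.le)
    simp only [h1]
    rw [Finset.sum_filter, Fin.sum_univ_eq_sum_range (fun i => if i < m then d (i + 1) - d i else 0),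
      ← Finset.sum_filter]
    have h2 : (Finset.range (r + 1)).filter (· < m) = Finset.range m := by
      ext i; simp; omega
    rw [h2, Finset.sum_range_sub, hd0, sub_zero]
  let v : stdSimplex ℝ (Fin (r + 1)) := ⟨fun i => d (i + 1) - d i, fun i =>
    sub_nonneg.2 (hdlt _ _ (Nat.lt_succ_self _) i.2).le, by
      rw [Fin.sum_univ_eq_sum_range (fun i => d (i + 1) - d i), Finset.sum_range_sub, hd0, hd1,
        sub_zero]⟩
  have main : ∀ {k' : ℕ} (w : stdSimplex ℝ (Fin (k' + 1))),
      (∀ i, partialSum w i < 1 → partialSum w i ∈ F) →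
      stdSimplex.map (sampleHom w c).toOrderHom v = w := by
    intro k' w hw
    refine partialSum_injective fun j => ?_
    rw [partialSum_map]
    obtain ⟨m, hm, hmj⟩ : ∃ m, m ≤ r + 1 ∧ d m = partialSum w j := by
      rcases (partialSum_le_one w j).lt_or_eq with h | h
      · have h2 : partialSum w j ∈ Set.range (F.orderEmbOfFin hr) := by
          rw [Finset.range_orderEmbOfFin F hr]; exact hw j h
        obtain ⟨i, hi⟩ := h2
        exact ⟨i, i.2.le, (hd i).trans hi⟩
      · exact ⟨r + 1, le_rfl, by rw [hd1, h]⟩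
    rw [← hmj, ← hsum m hm]
    refine Finset.sum_congr ?_ fun _ _ => rfl
    ext i
    simp only [Finset.mem_filter, Finset.mem_univ, true_and]
    rw [hmj]
    exact step_le_iff w (c i) j
  refine ⟨r, c, v, main s fun i hi => ?_, main t fun i hi => ?_⟩
  · simp [F, hi]
  · simp [F, hi]

/-- Two points of realizations can be represented with the same simplex coordinates. -/
theorem exists_common_rep {X : SimplicialObject TopCat.{u}} {Y : SimplicialObject TopCat.{u}}
    (p : Realization X) (q : Realization Y) :
    ∃ (r : ℕ) (x : X.obj (op (SimplexCategory.mk r))) (y : Y.obj (op (SimplexCategory.mk r)))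
      (v : stdSimplex ℝ (Fin (r + 1))), p = Realization.mk x v ∧ q = Realization.mk y v := by
  obtain ⟨k, x, s, rfl⟩ := p.exists_rep
  obtain ⟨l, y, t, rfl⟩ := q.exists_rep
  obtain ⟨r, c, v, hs, ht⟩ := exists_common s t
  refine ⟨r, X.map (sampleHom s c).op x, Y.map (sampleHom t c).op y, v, ?_, ?_⟩
  · rw [← Realization.glue, hs]
  · rw [← Realization.glue, ht]

/-! ### Topological categories and their nerves -/

/-- A topological category (category object in topological spaces): spaces of objects and of
morphisms, with continuous structure maps. `comp g f _` is the composite `g ∘ f`, defined when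
`dom g = cod f`. -/
structure TopCategory where
  Ob : Type u
  Mor : Type u
  [topOb : TopologicalSpace Ob]
  [topMor : TopologicalSpace Mor]
  dom : Mor → Ob
  cod : Mor → Ob
  ident : Ob → Mor
  comp : (g f : Mor) → dom g = cod f → Mor
  dom_ident : ∀ x, dom (ident x) = x
  cod_ident : ∀ x, cod (ident x) = x
  dom_comp : ∀ g f h, dom (comp g f h) = dom f
  cod_comp : ∀ g f h, cod (comp g f h) = cod g
  comp_ident : ∀ f, comp f (ident (dom f)) (cod_ident _).symm = f
  ident_comp : ∀ f, comp (ident (cod f)) f (dom_ident _) = f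
  assoc : ∀ h g f (hg : dom h = cod g) (gf : dom g = cod f),
    comp (comp h g hg) f ((dom_comp _ _ _).trans gf) =
      comp h (comp g f gf) (hg.trans (cod_comp _ _ _).symm)
  continuous_dom : Continuous dom
  continuous_cod : Continuous cod
  continuous_ident : Continuous ident
  continuous_comp : Continuous fun p : {p : Mor × Mor // dom p.1 = cod p.2} =>
    comp p.1.1 p.1.2 p.2

attribute [instance] TopCategory.topOb TopCategory.topMor

/-- A continuous functor. -/
structure TopFunctor (C : TopCategory.{u}) (D : TopCategory.{w}) where
  obj : C.Ob → D.Ob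
  mor : C.Mor → D.Mor
  continuous_obj : Continuous obj
  continuous_mor : Continuous mor
  dom_mor : ∀ f, D.dom (mor f) = obj (C.dom f)
  cod_mor : ∀ f, D.cod (mor f) = obj (C.cod f)
  mor_ident : ∀ x, mor (C.ident x) = D.ident (obj x)
  mor_comp : ∀ g f (h : C.dom g = C.cod f),
    mor (C.comp g f h) =
      D.comp (mor g) (mor f) ((dom_mor g).trans ((congrArg obj h).trans (cod_mor f).symm))

/-- The product of two topological categories. -/
abbrev TopCategory.prod (C D : TopCategory.{u}) : TopCategory.{u} where
  Ob := C.Ob × D.Ob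
  Mor := C.Mor × D.Mor
  dom f := (C.dom f.1, D.dom f.2)
  cod f := (C.cod f.1, D.cod f.2)
  ident x := (C.ident x.1, D.ident x.2)
  comp g f h := (C.comp g.1 f.1 (congrArg Prod.fst h), D.comp g.2 f.2 (congrArg Prod.snd h))
  dom_ident x := by simp [C.dom_ident, D.dom_ident]
  cod_ident x := by simp [C.cod_ident, D.cod_ident]
  dom_comp g f h := by simp [C.dom_comp, D.dom_comp]
  cod_comp g f h := by simp [C.cod_comp, D.cod_comp]
  comp_ident f := by simp [C.comp_ident, D.comp_ident]
  ident_comp f := by simp [C.ident_comp, D.ident_comp]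
  assoc h g f hg gf := Prod.ext (C.assoc _ _ _ _ _) (D.assoc _ _ _ _ _)
  continuous_dom := (C.continuous_dom.comp continuous_fst).prodMk
    (D.continuous_dom.comp continuous_snd)
  continuous_cod := (C.continuous_cod.comp continuous_fst).prodMk
    (D.continuous_cod.comp continuous_snd)
  continuous_ident := (C.continuous_ident.comp continuous_fst).prodMk
    (D.continuous_ident.comp continuous_snd)
  continuous_comp := by
    refine Continuous.prodMk ?_ ?_
    · exact C.continuous_comp.comp (Continuous.subtype_mk
        (f := fun p : {p : (C.Mor × D.Mor) × (C.Mor × D.Mor) //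
          (C.dom p.1.1, D.dom p.1.2) = (C.cod p.2.1, D.cod p.2.2)} => (p.1.1.1, p.1.2.1))
        (by fun_prop) fun p => congrArg Prod.fst p.2)
    · exact D.continuous_comp.comp (Continuous.subtype_mk
        (f := fun p : {p : (C.Mor × D.Mor) × (C.Mor × D.Mor) //
          (C.dom p.1.1, D.dom p.1.2) = (C.cod p.2.1, D.cod p.2.2)} => (p.1.1.2, p.1.2.2))
        (by fun_prop) fun p => congrArg Prod.snd p.2)

/-- A `k`-simplex of the nerve: a functor from the poset `[k] = {0 < ⋯ < k}` to `C`, that is, a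
composable string `x₀ → x₁ → ⋯ → xₖ` together with all its composites. -/
@[ext]
structure Chain (C : TopCategory.{u}) (k : ℕ) where
  obj : Fin (k + 1) → C.Ob
  mor : (i j : Fin (k + 1)) → i ≤ j → C.Mor
  dom_mor : ∀ i j h, C.dom (mor i j h) = obj i
  cod_mor : ∀ i j h, C.cod (mor i j h) = obj j
  mor_self : ∀ i, mor i i le_rfl = C.ident (obj i)
  mor_comp : ∀ i j l (hij : i ≤ j) (hjl : j ≤ l),
    C.comp (mor j l hjl) (mor i j hij) ((dom_mor j l hjl).trans (cod_mor i j hij).symm) =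
      mor i l (hij.trans hjl)

/-- The topology on `k`-simplices as a subspace of a finite product of copies of the spaces of
objects and of morphisms. Since composition is continuous, this is the same as the topology of the
iterated fibre product `Mor ×_Ob ⋯ ×_Ob Mor`. -/
instance (C : TopCategory.{u}) (k : ℕ) : TopologicalSpace (Chain C k) :=
  TopologicalSpace.induced (fun s => (s.obj,
    fun p : {p : Fin (k + 1) × Fin (k + 1) // p.1 ≤ p.2} => s.mor p.1.1 p.1.2 p.2)) inferInstance

/-- Precomposition of a functor `[l] → C` with a monotone map `[k] → [l]`. -/
def Chain.precomp {C : TopCategory.{u}} {k l : ℕ} (s : Chain C l)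
    (θ : Fin (k + 1) →o Fin (l + 1)) : Chain C k where
  obj i := s.obj (θ i)
  mor i j h := s.mor (θ i) (θ j) (θ.monotone h)
  dom_mor _ _ _ := s.dom_mor _ _ _
  cod_mor _ _ _ := s.cod_mor _ _ _
  mor_self _ := s.mor_self _
  mor_comp _ _ _ _ _ := s.mor_comp _ _ _ _ _

theorem Chain.continuous_precomp {C : TopCategory.{u}} {k l : ℕ}
    (θ : Fin (k + 1) →o Fin (l + 1)) : Continuous fun s : Chain C l => s.precomp θ := by
  have h : Continuous fun s : Chain C l => (s.obj,
      fun p : {p : Fin (l + 1) × Fin (l + 1) // p.1 ≤ p.2} => s.mor p.1.1 p.1.2 p.2) :=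
    continuous_induced_dom
  refine continuous_induced_rng.2 (Continuous.prodMk ?_ ?_)
  · exact continuous_pi fun i => (continuous_apply (θ i)).comp h.fst
  · exact continuous_pi fun p =>
      (continuous_apply (⟨(θ p.1.1, θ p.1.2), θ.monotone p.2⟩ :
        {p : Fin (l + 1) × Fin (l + 1) // p.1 ≤ p.2})).comp h.snd

/-- The nerve of a topological category, a simplicial space. -/
def TopCategory.nerve (C : TopCategory.{u}) : SimplicialObject TopCat.{u} where
  obj Δ := TopCat.of (Chain C Δ.unop.len)
  map θ := TopCat.ofHom ⟨fun s => s.precomp θ.unop.toOrderHom, Chain.continuous_precomp _⟩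
  map_id _ := rfl
  map_comp _ _ := rfl

/-- The classifying space `|C|` of a topological category. -/
abbrev TopCategory.real (C : TopCategory.{u}) : Type u := Realization C.nerve

/-- The point `[x₀ → ⋯ → xₖ, t]` of `|C|`. -/
def TopCategory.pt {C : TopCategory.{u}} {k : ℕ} (x : Chain C k)
    (t : stdSimplex ℝ (Fin (k + 1))) : C.real :=
  Realization.mk (X := C.nerve) x t

theorem TopCategory.pt_glue {C : TopCategory.{u}} {k l : ℕ} (θ : Fin (k + 1) →o Fin (l + 1))
    (x : Chain C l) (t : stdSimplex ℝ (Fin (k + 1))) :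
    pt x (stdSimplex.map θ t) = pt (x.precomp θ) t :=
  Realization.glue (X := C.nerve) (SimplexCategory.mkHom θ) x t

theorem TopCategory.exists_rep {C : TopCategory.{u}} (p : C.real) :
    ∃ (k : ℕ) (x : Chain C k) (t : stdSimplex ℝ (Fin (k + 1))), p = pt x t :=
  Realization.exists_rep p

theorem TopCategory.exists_common_rep {C D : TopCategory.{u}} (p : C.real) (q : D.real) :
    ∃ (r : ℕ) (x : Chain C r) (y : Chain D r) (v : stdSimplex ℝ (Fin (r + 1))),
      p = pt x v ∧ q = pt y v :=
  DefK.exists_common_rep p q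

theorem TopCategory.exists_common_rep₃ {C D E : TopCategory.{u}} (p : C.real) (q : D.real)
    (q' : E.real) :
    ∃ (r : ℕ) (x : Chain C r) (y : Chain D r) (z : Chain E r) (v : stdSimplex ℝ (Fin (r + 1))),
      p = pt x v ∧ q = pt y v ∧ q' = pt z v := by
  obtain ⟨k, x, y, s, rfl, rfl⟩ := exists_common_rep p q
  obtain ⟨l, z, t, rfl⟩ := TopCategory.exists_rep q'
  obtain ⟨r, c, v, hs, ht⟩ := exists_common s t
  refine ⟨r, x.precomp (sampleHom s c).toOrderHom, y.precomp (sampleHom s c).toOrderHom,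
    z.precomp (sampleHom t c).toOrderHom, v, ?_, ?_, ?_⟩
  · rw [← pt_glue, hs]
  · rw [← pt_glue, hs]
  · rw [← pt_glue, ht]

/-- The action of a functor on simplices of the nerve. -/
def TopFunctor.mapChain {C : TopCategory.{u}} {D : TopCategory.{w}} (F : TopFunctor C D) {k : ℕ}
    (s : Chain C k) : Chain D k where
  obj i := F.obj (s.obj i)
  mor i j h := F.mor (s.mor i j h)
  dom_mor i j h := by rw [F.dom_mor, s.dom_mor]
  cod_mor i j h := by rw [F.cod_mor, s.cod_mor]
  mor_self i := by rw [s.mor_self, F.mor_ident]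
  mor_comp i j l hij hjl := by
    rw [← F.mor_comp _ _ ((s.dom_mor j l hjl).trans (s.cod_mor i j hij).symm), s.mor_comp]

/-- The map of classifying spaces induced by a continuous functor. -/
def TopFunctor.real {C : TopCategory.{u}} {D : TopCategory.{w}} (F : TopFunctor C D) :
    C.real → D.real :=
  Realization.map (X := C.nerve) (Y := D.nerve) (fun _ s => F.mapChain s) fun _ _ => rfl

theorem TopFunctor.real_pt {C : TopCategory.{u}} {D : TopCategory.{w}} (F : TopFunctor C D) {k : ℕ}
    (x : Chain C k) (t : stdSimplex ℝ (Fin (k + 1))) :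
    F.real (TopCategory.pt x t) = TopCategory.pt (F.mapChain x) t := rfl

/-- The first projection from a product category. -/
def TopCategory.fst (C D : TopCategory.{u}) : TopFunctor (C.prod D) C where
  obj := Prod.fst
  mor := Prod.fst
  continuous_obj := continuous_fst
  continuous_mor := continuous_fst
  dom_mor _ := rfl
  cod_mor _ := rfl
  mor_ident _ := rfl
  mor_comp _ _ _ := rfl

/-- The second projection from a product category. -/
def TopCategory.snd (C D : TopCategory.{u}) : TopFunctor (C.prod D) D where
  obj := Prod.snd
  mor := Prod.snd
  continuous_obj := continuous_snd
  continuous_mor := continuous_snd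
  dom_mor _ := rfl
  cod_mor _ := rfl
  mor_ident _ := rfl
  mor_comp _ _ _ := rfl

/-- The simplex of the nerve of `C × D` with the given components. -/
def Chain.prod {C D : TopCategory.{u}} {k : ℕ} (x : Chain C k) (y : Chain D k) :
    Chain (C.prod D) k where
  obj i := (x.obj i, y.obj i)
  mor i j h := (x.mor i j h, y.mor i j h)
  dom_mor i j h := Prod.ext (x.dom_mor i j h) (y.dom_mor i j h)
  cod_mor i j h := Prod.ext (x.cod_mor i j h) (y.cod_mor i j h)
  mor_self i := Prod.ext (x.mor_self i) (y.mor_self i)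
  mor_comp i j l hij hjl := Prod.ext (x.mor_comp i j l hij hjl) (y.mor_comp i j l hij hjl)

/-- The projections induce a bijection `|C × D| → |C| × |D|`. -/
theorem TopCategory.prod_bijective (C D : TopCategory.{u}) :
    Function.Bijective fun p : (C.prod D).real => ((C.fst D).real p, (C.snd D).real p) := by
  constructor
  · intro p q hpq
    obtain ⟨k, x, s, rfl⟩ := TopCategory.exists_rep p
    obtain ⟨l, y, t, rfl⟩ := TopCategory.exists_rep q
    obtain ⟨r, c, v, hs, ht⟩ := exists_common s t
    have h1 := congrArg (sample c) (congrArg Prod.fst hpq)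
    have h2 := congrArg (sample c) (congrArg Prod.snd hpq)
    have h : x.precomp (sampleHom s c).toOrderHom = y.precomp (sampleHom t c).toOrderHom := by
      have h1o := congrArg Chain.obj h1
      have h2o := congrArg Chain.obj h2
      have h1m := congrArg Chain.mor h1
      have h2m := congrArg Chain.mor h2
      refine Chain.ext ?_ ?_
      · funext i
        exact Prod.ext (congrFun h1o i) (congrFun h2o i)
      · funext i j hij
        exact Prod.ext (congrFun (congrFun (congrFun h1m i) j) hij)
          (congrFun (congrFun (congrFun h2m i) j) hij)
    calc pt x s = pt x (stdSimplex.map (sampleHom s c).toOrderHom v) := by rw [hs]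
      _ = pt y (stdSimplex.map (sampleHom t c).toOrderHom v) := by rw [pt_glue, pt_glue, h]
      _ = pt y t := by rw [ht]
  · rintro ⟨p, q⟩
    obtain ⟨r, x, y, v, rfl, rfl⟩ := exists_common_rep p q
    exact ⟨pt (x.prod y) v, rfl⟩

/-- The pairing `|C| × |D| → |E|` induced by a functor `C × D → E`: the composite of `|C × D| → |E|`
with the inverse of the bijection `|C × D| → |C| × |D|` given by the projections. -/
def TopFunctor.real₂ {C D : TopCategory.{u}} {E : TopCategory.{w}} (F : TopFunctor (C.prod D) E)
    (p : C.real) (q : D.real) : E.real :=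
  F.real ((Equiv.ofBijective _ (C.prod_bijective D)).symm (p, q))

theorem TopFunctor.real₂_pt {C D : TopCategory.{u}} {E : TopCategory.{w}}
    (F : TopFunctor (C.prod D) E) {k : ℕ} (x : Chain C k) (y : Chain D k)
    (t : stdSimplex ℝ (Fin (k + 1))) :
    F.real₂ (TopCategory.pt x t) (TopCategory.pt y t) =
      TopCategory.pt (F.mapChain (x.prod y)) t := by
  unfold real₂
  have : (Equiv.ofBijective _ (C.prod_bijective D)).symm (TopCategory.pt x t, TopCategory.pt y t) =
      TopCategory.pt (x.prod y) t := by
    rw [Equiv.symm_apply_eq]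
    rfl
  rw [this]
  rfl

/-! ### Unitary groups, representation spaces and block sums -/

/-- The unitary group `U(n)`, with its topology as a space of complex matrices. -/
abbrev U (n : ℕ) : Type := Matrix.unitaryGroup (Fin n) ℂ

/-- The block sum `A ⊕ B ∈ U(n + m)` of `A ∈ U(n)` and `B ∈ U(m)`. -/
def blockSum {n m : ℕ} (A : U n) (B : U m) : U (n + m) :=
  ⟨(Matrix.fromBlocks (A : Matrix (Fin n) (Fin n) ℂ) 0 0 (B : Matrix (Fin m) (Fin m) ℂ)).submatrix
      finSumFinEquiv.symm finSumFinEquiv.symm, by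
    rw [Matrix.mem_unitaryGroup_iff, Matrix.star_eq_conjTranspose, Matrix.conjTranspose_submatrix,
      Matrix.submatrix_mul_equiv, Matrix.fromBlocks_conjTranspose, Matrix.fromBlocks_multiply,
      ← Matrix.star_eq_conjTranspose, ← Matrix.star_eq_conjTranspose,
      Matrix.mem_unitaryGroup_iff.1 A.2, Matrix.mem_unitaryGroup_iff.1 B.2]
    simp⟩

theorem blockSum_mul {n m : ℕ} (A A' : U n) (B B' : U m) :
    blockSum (A * A') (B * B') = blockSum A B * blockSum A' B' := by
  apply Subtype.ext
  simp [blockSum, Matrix.submatrix_mul_equiv, Matrix.fromBlocks_multiply]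

theorem blockSum_one {n m : ℕ} : blockSum (1 : U n) (1 : U m) = 1 := by
  apply Subtype.ext
  simp [blockSum]

theorem blockSum_inv {n m : ℕ} (A : U n) (B : U m) :
    blockSum A⁻¹ B⁻¹ = (blockSum A B)⁻¹ := by
  rw [eq_inv_iff_mul_eq_one, ← blockSum_mul, inv_mul_cancel, inv_mul_cancel, blockSum_one]

theorem continuous_blockSum {n m : ℕ} : Continuous fun p : U n × U m => blockSum p.1 p.2 := by
  refine Continuous.subtype_mk ?_ _
  refine Continuous.matrix_submatrix (Continuous.matrix_fromBlocks ?_ ?_ ?_ ?_) _ _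
  all_goals fun_prop

theorem heq_of_entries {n m : ℕ} (h : n = m) {A : U n} {B : U m}
    (hAB : ∀ i j, A.1 i j = B.1 (Fin.cast h i) (Fin.cast h j)) : HEq A B := by
  subst h
  exact heq_of_eq (Subtype.ext (Matrix.ext hAB))

theorem blockSum_assoc {n m l : ℕ} (A : U n) (B : U m) (C : U l) :
    HEq (blockSum (blockSum A B) C) (blockSum A (blockSum B C)) := by
  refine heq_of_entries (Nat.add_assoc n m l) fun i j => ?_
  have e1 : ∀ x : Fin n, Fin.cast (Nat.add_assoc n m l) (Fin.castAdd l (Fin.castAdd m x)) =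
      Fin.castAdd (m + l) x := fun x => rfl
  have e2 : ∀ x : Fin m, Fin.cast (Nat.add_assoc n m l) (Fin.castAdd l (Fin.natAdd n x)) =
      Fin.natAdd n (Fin.castAdd l x) := fun x => rfl
  have e3 : ∀ x : Fin l, Fin.cast (Nat.add_assoc n m l) (Fin.natAdd (n + m) x) =
      Fin.natAdd n (Fin.natAdd m x) := fun x => Fin.ext (Nat.add_assoc n m x)
  refine Fin.addCases (fun i => Fin.addCases (fun i => ?_) (fun i => ?_) i) (fun i => ?_) i <;>
  refine Fin.addCases (fun j => Fin.addCases (fun j => ?_) (fun j => ?_) j) (fun j => ?_) j <;>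
  simp only [e1, e2, e3, blockSum, Matrix.submatrix_apply, finSumFinEquiv_symm_apply_castAdd,
    finSumFinEquiv_symm_apply_natAdd, Matrix.fromBlocks_apply₁₁, Matrix.fromBlocks_apply₁₂,
    Matrix.fromBlocks_apply₂₁, Matrix.fromBlocks_apply₂₂, Matrix.zero_apply]

theorem zero_blockSum {n : ℕ} (Z : U 0) (A : U n) : HEq (blockSum Z A) A := by
  refine heq_of_entries (Nat.zero_add n) fun i j => ?_
  have e : ∀ x : Fin n, Fin.cast (Nat.zero_add n) (Fin.natAdd 0 x) = x :=
    fun x => Fin.ext (Nat.zero_add x)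
  refine Fin.addCases (fun i => i.elim0) (fun i => ?_) i
  refine Fin.addCases (fun j => j.elim0) (fun j => ?_) j
  simp only [e, blockSum, Matrix.submatrix_apply, finSumFinEquiv_symm_apply_natAdd,
    Matrix.fromBlocks_apply₂₂]

theorem blockSum_zero {n : ℕ} (A : U n) (Z : U 0) : HEq (blockSum A Z) A := by
  refine heq_of_entries (Nat.add_zero n) fun i j => ?_
  have e : ∀ x : Fin n, Fin.cast (Nat.add_zero n) (Fin.castAdd 0 x) = x := fun x => rfl
  refine Fin.addCases (fun i => ?_) (fun i => i.elim0) i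
  refine Fin.addCases (fun j => ?_) (fun j => j.elim0) j
  simp only [e, blockSum, Matrix.submatrix_apply, finSumFinEquiv_symm_apply_castAdd,
    Matrix.fromBlocks_apply₁₁]

/-- The representation space `Hom(G, U(n))` of the discrete group `G`. -/
def RepSpace (G : Type u) [Group G] (n : ℕ) : Type u := G →* U n

variable {G : Type u} [Group G]

instance {n : ℕ} : FunLike (RepSpace G n) G (U n) := inferInstanceAs (FunLike (G →* U n) G (U n))

instance {n : ℕ} : MonoidHomClass (RepSpace G n) G (U n) :=
  inferInstanceAs (MonoidHomClass (G →* U n) G (U n))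

/-- The topology of `Hom(G, U(n))` as a subspace of the product `∏_{g ∈ G} U(n)`; since `G` is
discrete, this is the compact-open topology. -/
instance {n : ℕ} : TopologicalSpace (RepSpace G n) :=
  TopologicalSpace.induced (fun ρ => (ρ : G → U n)) inferInstance

namespace RepSpace

@[ext]
theorem ext {n : ℕ} {ρ ψ : RepSpace G n} (h : ∀ g, ρ g = ψ g) : ρ = ψ := DFunLike.ext _ _ h

theorem continuous_eval {n : ℕ} (g : G) : Continuous fun ρ : RepSpace G n => ρ g :=
  (continuous_apply g).comp continuous_induced_dom

theorem continuous_rng {X : Type*} [TopologicalSpace X] {n : ℕ} {f : X → RepSpace G n}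
    (h : ∀ g, Continuous fun x => f x g) : Continuous f :=
  continuous_induced_rng.2 (continuous_pi h)

/-- The conjugate representation `A ρ A⁻¹`. -/
def conj {n : ℕ} (A : U n) (ρ : RepSpace G n) : RepSpace G n :=
  MonoidHom.mk' (fun g => A * ρ g * A⁻¹) fun g h => by rw [map_mul]; group

@[simp]
theorem conj_apply {n : ℕ} (A : U n) (ρ : RepSpace G n) (g : G) : conj A ρ g = A * ρ g * A⁻¹ := rfl

theorem conj_conj {n : ℕ} (A B : U n) (ρ : RepSpace G n) :
    conj A (conj B ρ) = conj (A * B) ρ := by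
  ext1 g; simp only [conj_apply]; group

theorem conj_one {n : ℕ} (ρ : RepSpace G n) : conj 1 ρ = ρ := by
  ext1 g; simp

theorem continuous_conj {n : ℕ} : Continuous fun p : U n × RepSpace G n => conj p.1 p.2 :=
  continuous_rng fun g => by
    have := (continuous_eval (G := G) (n := n) g).comp (continuous_snd (X := U n))
    exact (continuous_fst.mul this).mul continuous_fst.inv

theorem continuous_conj_left {n : ℕ} (ρ : RepSpace G n) : Continuous fun A : U n => conj A ρ :=
  continuous_rng fun _ => (continuous_id.mul continuous_const).mul continuous_inv

/-- The block sum `ρ ⊕ ψ` of representations. -/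
def sum {n m : ℕ} (ρ : RepSpace G n) (ψ : RepSpace G m) : RepSpace G (n + m) :=
  MonoidHom.mk' (fun g => blockSum (ρ g) (ψ g)) fun g h => by
    rw [map_mul, map_mul, blockSum_mul]

@[simp]
theorem sum_apply {n m : ℕ} (ρ : RepSpace G n) (ψ : RepSpace G m) (g : G) :
    sum ρ ψ g = blockSum (ρ g) (ψ g) := rfl

theorem continuous_sum {n m : ℕ} :
    Continuous fun p : RepSpace G n × RepSpace G m => sum p.1 p.2 :=
  continuous_rng fun g => continuous_blockSum.comp
    (((continuous_eval g).comp continuous_fst).prodMk ((continuous_eval g).comp continuous_snd))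

theorem conj_sum {n m : ℕ} (A : U n) (B : U m) (ρ : RepSpace G n) (ψ : RepSpace G m) :
    conj (blockSum A B) (sum ρ ψ) = sum (conj A ρ) (conj B ψ) := by
  ext1 g; simp only [conj_apply, sum_apply, blockSum_mul, blockSum_inv]

/-- The unique representation of dimension zero. -/
def triv : RepSpace G 0 := (1 : G →* U 0)

theorem heq {n m : ℕ} (h : n = m) {ρ : RepSpace G n} {ψ : RepSpace G m}
    (hρ : ∀ g, HEq (ρ g) (ψ g)) : HEq ρ ψ := by
  subst h
  exact heq_of_eq (RepSpace.ext fun g => eq_of_heq (hρ g))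

end RepSpace

/-! ### The topological category `R(G)` and its classifying space -/

theorem continuous_sigma_prod {A B : ℕ → Type u} [∀ n, TopologicalSpace (A n)]
    [∀ n, TopologicalSpace (B n)] {X : Type w} [TopologicalSpace X]
    {f : (Σ n, A n) × (Σ n, B n) → X}
    (h : ∀ n m, Continuous fun p : A n × B m => f (⟨n, p.1⟩, ⟨m, p.2⟩)) : Continuous f := by
  refine continuous_iff_continuousAt.2 ?_
  rintro ⟨⟨n, a⟩, ⟨m, b⟩⟩
  exact (Topology.IsOpenEmbedding.sigmaMk.prodMap Topology.IsOpenEmbedding.sigmaMk).continuousAt_iff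
    (x := (a, b)) |>.1 (h n m).continuousAt

/-- Transport of unitary matrices along an equality of dimensions. -/
def castU {n m : ℕ} (h : n = m) (A : U n) : U m := h ▸ A

/-- The space of objects `∐ₙ Hom(G, U(n))` of `R(G)`. -/
abbrev RepOb (G : Type u) [Group G] : Type u := Σ n : ℕ, RepSpace G n

/-- The space of morphisms `∐ₙ U(n) × Hom(G, U(n))` of `R(G)`. -/
abbrev RepMor (G : Type u) [Group G] : Type u := Σ n : ℕ, U n × RepSpace G n

theorem continuous_repMor_mk {X : Type w} [TopologicalSpace X] {n : ℕ} {f : X → U n}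
    {ρ : X → RepSpace G n} (hf : Continuous f) (hρ : Continuous ρ) :
    Continuous fun x => (⟨n, f x, ρ x⟩ : RepMor G) :=
  (continuous_sigmaMk (σ := fun n : ℕ => U n × RepSpace G n)).comp (hf.prodMk hρ)

/-- The topological category `R(G)`: its objects are the unitary representations of `G`, and a
morphism `(A, ρ)` is the unitary isomorphism `A : ρ → A ρ A⁻¹`. -/
abbrev repCategory (G : Type u) [Group G] : TopCategory.{u} where
  Ob := RepOb G
  Mor := RepMor G
  dom f := ⟨f.1, f.2.2⟩
  cod f := ⟨f.1, RepSpace.conj f.2.1 f.2.2⟩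
  ident x := ⟨x.1, 1, x.2⟩
  comp g f h := ⟨f.1, castU (congrArg Sigma.fst h) g.2.1 * f.2.1, f.2.2⟩
  dom_ident _ := rfl
  cod_ident x := by simp only [RepSpace.conj_one]
  dom_comp _ _ _ := rfl
  cod_comp := by
    rintro ⟨n, B, ψ⟩ ⟨m, A, ρ⟩ h
    obtain rfl : n = m := congrArg Sigma.fst h
    obtain rfl : ψ = RepSpace.conj A ρ := eq_of_heq (Sigma.mk.inj h).2
    simp only [castU, RepSpace.conj_conj]
  comp_ident := by
    rintro ⟨n, A, ρ⟩
    simp only [castU, mul_one]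
  ident_comp := by
    rintro ⟨n, A, ρ⟩
    simp only [castU, one_mul]
  assoc := by
    rintro ⟨n, C, φ⟩ ⟨m, B, ψ⟩ ⟨l, A, ρ⟩ h1 h2
    obtain rfl : n = m := congrArg Sigma.fst h1
    obtain rfl : n = l := congrArg Sigma.fst h2
    simp only [castU, mul_assoc]
  continuous_dom := continuous_sigma fun n => continuous_sigmaMk.comp continuous_snd
  continuous_cod := continuous_sigma fun n => continuous_sigmaMk.comp RepSpace.continuous_conj
  continuous_ident := continuous_sigma fun n =>
    show Continuous fun ρ : RepSpace G n => (⟨n, 1, ρ⟩ : RepMor G) from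
      continuous_repMor_mk continuous_const continuous_id
  continuous_comp := by
    let c : RepMor G × RepMor G → RepMor G := fun p =>
      ⟨p.2.1, (if h : p.1.1 = p.2.1 then castU h p.1.2.1 else 1) * p.2.2.1, p.2.2.2⟩
    have hc : Continuous c := continuous_sigma_prod fun n m => by
      have h1 : Continuous fun p : (U n × RepSpace G n) × (U m × RepSpace G m) =>
          if h : n = m then castU h p.1.1 else 1 := by
        by_cases h : n = m
        · subst h
          simp only [castU, dite_true]
          fun_prop
        · simp only [h, dite_false]
          fun_prop
      exact continuous_repMor_mk (h1.mul (continuous_fst.comp continuous_snd))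
        (continuous_snd.comp continuous_snd)
    have : (fun p : {p : RepMor G × RepMor G //
        (⟨p.1.1, p.1.2.2⟩ : RepOb G) = ⟨p.2.1, RepSpace.conj p.2.2.1 p.2.2.2⟩} =>
        (⟨p.1.2.1, castU (congrArg (fun x : RepOb G => x.1) p.2) p.1.1.2.1 * p.1.2.2.1,
          p.1.2.2.2⟩ : RepMor G)) = fun p => c p.1 := by
      funext p
      have h : p.1.1.1 = p.1.2.1 := congrArg (fun x : RepOb G => x.1) p.2
      simp only [c, h, dite_true]
    rw [this]
    exact hc.comp continuous_subtype_val

/-- The block sum functor `⊕ : R(G) × R(G) → R(G)`. -/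
def repSum (G : Type u) [Group G] :
    TopFunctor ((repCategory G).prod (repCategory G)) (repCategory G) where
  obj x := ⟨x.1.1 + x.2.1, RepSpace.sum x.1.2 x.2.2⟩
  mor f := ⟨f.1.1 + f.2.1, blockSum f.1.2.1 f.2.2.1, RepSpace.sum f.1.2.2 f.2.2.2⟩
  continuous_obj := continuous_sigma_prod fun n m =>
    (continuous_sigmaMk (σ := RepSpace G) (i := n + m)).comp RepSpace.continuous_sum
  continuous_mor := continuous_sigma_prod fun n m => continuous_repMor_mk
    (continuous_blockSum.comp (by fun_prop : Continuous fun p :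
      (U n × RepSpace G n) × (U m × RepSpace G m) => (p.1.1, p.2.1)))
    (RepSpace.continuous_sum.comp (by fun_prop : Continuous fun p :
      (U n × RepSpace G n) × (U m × RepSpace G m) => (p.1.2, p.2.2)))
  dom_mor _ := rfl
  cod_mor f := by
    simp only [repCategory, TopCategory.prod, RepSpace.conj_sum]
  mor_ident x := by
    simp only [repCategory, TopCategory.prod, blockSum_one]
  mor_comp := by
    rintro ⟨⟨n, B, ψ⟩, ⟨n', B', ψ'⟩⟩ ⟨⟨m, A, ρ⟩, ⟨m', A', ρ'⟩⟩ h
    obtain rfl : n = m := congrArg Sigma.fst (congrArg Prod.fst h)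
    obtain rfl : n' = m' := congrArg Sigma.fst (congrArg Prod.snd h)
    simp only [repCategory, TopCategory.prod, castU, blockSum_mul]

theorem repMor_ext {n m : ℕ} (h : n = m) {A : U n} {B : U m} {ρ : RepSpace G n} {ψ : RepSpace G m}
    (hA : HEq A B) (hρ : ∀ g, HEq (ρ g) (ψ g)) :
    (⟨n, A, ρ⟩ : Σ n : ℕ, U n × RepSpace G n) = ⟨m, B, ψ⟩ := by
  have h2 := RepSpace.heq h hρ
  subst h
  rw [eq_of_heq hA, eq_of_heq h2]

/-- A simplex of the nerve is determined by its morphisms. -/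
theorem Chain.ext_mor {C : TopCategory.{u}} {k : ℕ} {x y : Chain C k}
    (h : ∀ i j hij, x.mor i j hij = y.mor i j hij) : x = y := by
  refine Chain.ext ?_ (funext fun i => funext fun j => funext fun hij => h i j hij)
  funext i
  rw [← x.dom_mor i i le_rfl, ← y.dom_mor i i le_rfl, h]

/-- The constant simplex at an object. -/
def Chain.const {C : TopCategory.{u}} (x : C.Ob) (k : ℕ) : Chain C k where
  obj _ := x
  mor _ _ _ := C.ident x
  dom_mor _ _ _ := C.dom_ident x
  cod_mor _ _ _ := C.cod_ident x
  mor_self _ := rfl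
  mor_comp _ _ _ _ _ := by
    have h : ∀ y (h1 : C.dom (C.ident x) = y) (h2 : C.dom (C.ident x) = C.cod (C.ident y)),
        C.comp (C.ident x) (C.ident y) h2 = C.ident x := by
      rintro _ rfl h2
      exact C.comp_ident _
    exact h x (C.dom_ident x) _

/-- The vertex of `|C|` given by an object. -/
def TopCategory.vertex {C : TopCategory.{u}} (x : C.Ob) : C.real :=
  pt (Chain.const x 0) (stdSimplex.vertex 0)

theorem TopCategory.vertex_eq {C : TopCategory.{u}} (x : C.Ob) {k : ℕ}
    (t : stdSimplex ℝ (Fin (k + 1))) : vertex x = pt (Chain.const x k) t := by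
  let θ : Fin (k + 1) →o Fin (0 + 1) := ⟨fun _ => 0, fun _ _ _ => le_rfl⟩
  have h : (stdSimplex.vertex 0 : stdSimplex ℝ (Fin (0 + 1))) = stdSimplex.map θ t :=
    Subsingleton.elim _ _
  unfold vertex
  rw [h, pt_glue]
  rfl

/-- The monoid `|R(G)|`: multiplication is induced by the block sum functor, and the unit is the
vertex given by the representation of dimension zero. -/
instance repRealMonoid (G : Type u) [Group G] : Monoid (repCategory G).real where
  mul p q := (repSum G).real₂ p q
  one := TopCategory.vertex (C := repCategory G) ⟨0, RepSpace.triv⟩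
  mul_assoc p q r := by
    obtain ⟨k, x, y, z, t, rfl, rfl, rfl⟩ := TopCategory.exists_common_rep₃ p q r
    change (repSum G).real₂ ((repSum G).real₂ _ _) _ = (repSum G).real₂ _ ((repSum G).real₂ _ _)
    rw [TopFunctor.real₂_pt, TopFunctor.real₂_pt, TopFunctor.real₂_pt, TopFunctor.real₂_pt]
    congr 1
    exact Chain.ext_mor fun i j h =>
      repMor_ext (Nat.add_assoc _ _ _) (blockSum_assoc _ _ _) fun g => blockSum_assoc _ _ _
  one_mul p := by
    obtain ⟨k, x, t, rfl⟩ := TopCategory.exists_rep p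
    change (repSum G).real₂ (TopCategory.vertex _) _ = _
    rw [TopCategory.vertex_eq _ t, TopFunctor.real₂_pt]
    congr 1
    exact Chain.ext_mor fun i j h =>
      repMor_ext (Nat.zero_add _) (zero_blockSum _ _) fun g => zero_blockSum _ _
  mul_one p := by
    obtain ⟨k, x, t, rfl⟩ := TopCategory.exists_rep p
    change (repSum G).real₂ _ (TopCategory.vertex _) = _
    rw [TopCategory.vertex_eq _ t, TopFunctor.real₂_pt]
    congr 1
    exact Chain.ext_mor fun i j h =>
      repMor_ext (Nat.add_zero _) (blockSum_zero _ _) fun g => blockSum_zero _ _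

/-! ### The space `EU(n)` and the homotopy orbit spaces -/

/-- The translation category of `U(n)`: its space of objects is `U(n)`, and `(A, B)` is the unique
morphism from `B` to `A`. -/
abbrev translation (n : ℕ) : TopCategory.{0} where
  Ob := U n
  Mor := U n × U n
  dom f := f.2
  cod f := f.1
  ident A := (A, A)
  comp g f _ := (g.1, f.2)
  dom_ident _ := rfl
  cod_ident _ := rfl
  dom_comp _ _ _ := rfl
  cod_comp _ _ _ := rfl
  comp_ident _ := rfl
  ident_comp _ := rfl
  assoc _ _ _ _ _ := rfl
  continuous_dom := continuous_snd
  continuous_cod := continuous_fst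
  continuous_ident := continuous_id.prodMk continuous_id
  continuous_comp := by fun_prop

/-- `EU(n)`, the classifying space of the translation category of `U(n)`. -/
abbrev EU (n : ℕ) : Type := (translation n).real

/-- Right translation `A ↦ A g`, as a functor. -/
def rightMul {n : ℕ} (g : U n) : TopFunctor (translation n) (translation n) where
  obj A := A * g
  mor f := (f.1 * g, f.2 * g)
  continuous_obj := continuous_id.mul continuous_const
  continuous_mor := (continuous_fst.mul continuous_const).prodMk
    (continuous_snd.mul continuous_const)
  dom_mor _ := rfl
  cod_mor _ := rfl
  mor_ident _ := rfl
  mor_comp _ _ _ := rfl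

/-- The block sum functor `(A, B) ↦ A ⊕ B` on translation categories. -/
def translationSum (n m : ℕ) :
    TopFunctor ((translation n).prod (translation m)) (translation (n + m)) where
  obj x := blockSum x.1 x.2
  mor f := (blockSum f.1.1 f.2.1, blockSum f.1.2 f.2.2)
  continuous_obj := continuous_blockSum
  continuous_mor := (continuous_blockSum.comp (by fun_prop : Continuous fun p :
      (U n × U n) × (U m × U m) => (p.1.1, p.2.1))).prodMk
    (continuous_blockSum.comp (by fun_prop : Continuous fun p :
      (U n × U n) × (U m × U m) => (p.1.2, p.2.2)))
  dom_mor _ := rfl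
  cod_mor _ := rfl
  mor_ident _ := rfl
  mor_comp _ _ _ := rfl

/-- The orbit relation of the right action `(e, ρ) · g = (e g, g⁻¹ ρ g)` of `U(n)` on
`EU(n) × Hom(G, U(n))`. -/
def OrbitRel (G : Type u) [Group G] (n : ℕ) (p q : EU n × RepSpace G n) : Prop :=
  ∃ g : U n, q = ((rightMul g).real p.1, RepSpace.conj g⁻¹ p.2)

/-- The homotopy orbit space `Hom(G, U(n))_{hU(n)} = EU(n) ×_{U(n)} Hom(G, U(n))`, with the quotient
topology. -/
def HomotopyOrbit (G : Type u) [Group G] (n : ℕ) : Type u := Quot (OrbitRel G n)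

instance (n : ℕ) : TopologicalSpace (HomotopyOrbit G n) :=
  inferInstanceAs (TopologicalSpace (Quot (OrbitRel G n)))

/-- The disjoint union `Rep(G)_{hU} = ∐ₙ EU(n) ×_{U(n)} Hom(G, U(n))`. -/
def RepHU (G : Type u) [Group G] : Type u := Σ n : ℕ, HomotopyOrbit G n

instance : TopologicalSpace (RepHU G) :=
  inferInstanceAs (TopologicalSpace (Σ n : ℕ, HomotopyOrbit G n))

/-- The class `[e, ρ]`. -/
def RepHU.mk {n : ℕ} (e : EU n) (ρ : RepSpace G n) : RepHU G := ⟨n, Quot.mk _ (e, ρ)⟩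

theorem translationSum_rightMul {n m : ℕ} (g : U n) (h : U m) (e : EU n) (e' : EU m) :
    (translationSum n m).real₂ ((rightMul g).real e) ((rightMul h).real e') =
      (rightMul (blockSum g h)).real ((translationSum n m).real₂ e e') := by
  obtain ⟨k, x, y, t, rfl, rfl⟩ := TopCategory.exists_common_rep e e'
  rw [TopFunctor.real₂_pt, TopFunctor.real_pt, TopFunctor.real_pt, TopFunctor.real_pt,
    TopFunctor.real₂_pt]
  congr 1
  refine Chain.ext_mor fun i j hij => ?_
  exact Prod.ext (blockSum_mul _ _ _ _) (blockSum_mul _ _ _ _)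

theorem rightMul_one {n : ℕ} (e : EU n) : (rightMul (1 : U n)).real e = e := by
  obtain ⟨k, x, t, rfl⟩ := TopCategory.exists_rep e
  rw [TopFunctor.real_pt]
  congr 1
  exact Chain.ext_mor fun i j hij => Prod.ext (mul_one _) (mul_one _)

theorem OrbitRel.sum {n m : ℕ} {p p' : EU n × RepSpace G n} {q q' : EU m × RepSpace G m}
    (hp : OrbitRel G n p p') (hq : OrbitRel G m q q') :
    OrbitRel G (n + m) ((translationSum n m).real₂ p.1 q.1, RepSpace.sum p.2 q.2)
      ((translationSum n m).real₂ p'.1 q'.1, RepSpace.sum p'.2 q'.2) := by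
  obtain ⟨g, rfl⟩ := hp
  obtain ⟨h, rfl⟩ := hq
  exact ⟨blockSum g h, by
    rw [translationSum_rightMul, ← RepSpace.conj_sum, blockSum_inv]⟩

theorem OrbitRel.refl {n : ℕ} (p : EU n × RepSpace G n) : OrbitRel G n p p :=
  ⟨1, by rw [rightMul_one, inv_one, RepSpace.conj_one]⟩

/-- The multiplication `[e₁, ρ₁] ⊕ [e₂, ρ₂] = [e₁ ⊕ e₂, ρ₁ ⊕ ρ₂]` on `Rep(G)_{hU}`. -/
instance : Mul (RepHU G) where
  mul p q := ⟨p.1 + q.1, Quot.map₂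
    (fun a b => ((translationSum p.1 q.1).real₂ a.1 b.1, RepSpace.sum a.2 b.2))
    (fun a _ _ h => (OrbitRel.refl a).sum h) (fun _ _ b h => h.sum (OrbitRel.refl b)) p.2 q.2⟩

theorem RepHU.mk_mul_mk {n m : ℕ} (e : EU n) (ρ : RepSpace G n) (e' : EU m) (ρ' : RepSpace G m) :
    RepHU.mk e ρ * RepHU.mk e' ρ' =
      RepHU.mk ((translationSum n m).real₂ e e') (RepSpace.sum ρ ρ') := rfl

theorem RepHU.exists_rep (p : RepHU G) :
    ∃ (n : ℕ) (e : EU n) (ρ : RepSpace G n), p = RepHU.mk e ρ := by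
  obtain ⟨n, q⟩ := p
  obtain ⟨⟨e, ρ⟩, rfl⟩ := Quot.exists_rep q
  exact ⟨n, e, ρ, rfl⟩

theorem RepHU.mk_ext {n m : ℕ} (h : n = m) {k : ℕ} {x : Chain (translation n) k}
    {y : Chain (translation m) k} {ρ : RepSpace G n} {ψ : RepSpace G m}
    (t : stdSimplex ℝ (Fin (k + 1)))
    (hxy : ∀ i j hij, HEq (x.mor i j hij).1 (y.mor i j hij).1 ∧
      HEq (x.mor i j hij).2 (y.mor i j hij).2)
    (hρ : ∀ g, HEq (ρ g) (ψ g)) :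
    RepHU.mk (TopCategory.pt x t) ρ = RepHU.mk (TopCategory.pt y t) ψ := by
  subst h
  obtain rfl : x = y := Chain.ext_mor fun i j hij =>
    Prod.ext (eq_of_heq (hxy i j hij).1) (eq_of_heq (hxy i j hij).2)
  obtain rfl : ρ = ψ := RepSpace.ext fun g => eq_of_heq (hρ g)
  rfl

/-- The monoid `Rep(G)_{hU}`; its unit is the unique point in dimension zero. -/
instance : Monoid (RepHU G) where
  one := RepHU.mk (TopCategory.vertex (C := translation 0) (1 : U 0)) RepSpace.triv
  mul_assoc p q r := by
    obtain ⟨n, e, ρ, rfl⟩ := p.exists_rep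
    obtain ⟨m, e', ρ', rfl⟩ := q.exists_rep
    obtain ⟨l, e'', ρ'', rfl⟩ := r.exists_rep
    obtain ⟨k, x, y, z, t, rfl, rfl, rfl⟩ := TopCategory.exists_common_rep₃ e e' e''
    rw [RepHU.mk_mul_mk, RepHU.mk_mul_mk, RepHU.mk_mul_mk, RepHU.mk_mul_mk, TopFunctor.real₂_pt,
      TopFunctor.real₂_pt, TopFunctor.real₂_pt, TopFunctor.real₂_pt]
    exact RepHU.mk_ext (Nat.add_assoc _ _ _) t
      (fun i j h => ⟨blockSum_assoc _ _ _, blockSum_assoc _ _ _⟩) fun g => blockSum_assoc _ _ _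
  one_mul p := by
    obtain ⟨n, e, ρ, rfl⟩ := p.exists_rep
    obtain ⟨k, x, t, rfl⟩ := TopCategory.exists_rep e
    change RepHU.mk (TopCategory.vertex (C := translation 0) (1 : U 0)) RepSpace.triv * _ = _
    rw [TopCategory.vertex_eq _ t, RepHU.mk_mul_mk, TopFunctor.real₂_pt]
    exact RepHU.mk_ext (Nat.zero_add _) t
      (fun i j h => ⟨zero_blockSum _ _, zero_blockSum _ _⟩) fun g => zero_blockSum _ _
  mul_one p := by
    obtain ⟨n, e, ρ, rfl⟩ := p.exists_rep
    obtain ⟨k, x, t, rfl⟩ := TopCategory.exists_rep e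
    change _ * RepHU.mk (TopCategory.vertex (C := translation 0) (1 : U 0)) RepSpace.triv = _
    rw [TopCategory.vertex_eq _ t, RepHU.mk_mul_mk, TopFunctor.real₂_pt]
    exact RepHU.mk_ext (Nat.add_zero _) t
      (fun i j h => ⟨blockSum_zero _ _, blockSum_zero _ _⟩) fun g => blockSum_zero _ _

/-! ### The map `α` -/

/-- For a representation `ρ`, the functor from the translation category of `U(n)` to `R(G)` sending
`A` to `A ρ A⁻¹` and the morphism `B → A` to `A B⁻¹ : B ρ B⁻¹ → A ρ A⁻¹`. -/
def orbitFunctor {n : ℕ} (ρ : RepSpace G n) : TopFunctor (translation n) (repCategory G) where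
  obj A := ⟨n, RepSpace.conj A ρ⟩
  mor f := ⟨n, f.1 * f.2⁻¹, RepSpace.conj f.2 ρ⟩
  continuous_obj := (continuous_sigmaMk (σ := RepSpace G)).comp (RepSpace.continuous_conj_left ρ)
  continuous_mor := continuous_repMor_mk (f := fun f : U n × U n => f.1 * f.2⁻¹)
    (continuous_fst.mul continuous_snd.inv)
    ((RepSpace.continuous_conj_left ρ).comp continuous_snd)
  dom_mor _ := rfl
  cod_mor f := by
    simp only [repCategory, RepSpace.conj_conj, inv_mul_cancel_right]
  mor_ident A := by
    simp only [repCategory, mul_inv_cancel]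
  mor_comp := by
    rintro ⟨C, B⟩ ⟨B', A⟩ h
    obtain rfl : B = B' := h
    simp only [repCategory, castU]
    congr 2
    group

theorem orbitFunctor_rightMul_mor {n : ℕ} (g : U n) (ρ : RepSpace G n) (f : U n × U n) :
    (⟨n, (f.1 * g) * (f.2 * g)⁻¹, RepSpace.conj (f.2 * g) (RepSpace.conj g⁻¹ ρ)⟩ : RepMor G) =
      ⟨n, f.1 * f.2⁻¹, RepSpace.conj f.2 ρ⟩ := by
  have h1 : (f.1 * g) * (f.2 * g)⁻¹ = f.1 * f.2⁻¹ := by group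
  have h2 : RepSpace.conj (f.2 * g) (RepSpace.conj g⁻¹ ρ) = RepSpace.conj f.2 ρ := by
    rw [RepSpace.conj_conj, mul_inv_cancel_right]
  rw [h1, h2]

theorem orbitFunctor_rightMul {n : ℕ} (g : U n) (ρ : RepSpace G n) (e : EU n) :
    (orbitFunctor (RepSpace.conj g⁻¹ ρ)).real ((rightMul g).real e) = (orbitFunctor ρ).real e := by
  obtain ⟨k, x, t, rfl⟩ := TopCategory.exists_rep e
  rw [TopFunctor.real_pt, TopFunctor.real_pt, TopFunctor.real_pt]
  exact congrArg (fun c => TopCategory.pt c t)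
    (Chain.ext_mor fun i j hij => orbitFunctor_rightMul_mor g ρ (x.mor i j hij))

/-- The map `α : Rep(G)_{hU} → |R(G)|`, which sends `[A₀ → A₁ → ⋯ → Aₖ, t, ρ]` to
`[A₀ ρ A₀⁻¹ → A₁ ρ A₁⁻¹ → ⋯ → Aₖ ρ Aₖ⁻¹, t]`, where the `i`-th arrow is `Aᵢ Aᵢ₋₁⁻¹`. -/
def alpha (G : Type u) [Group G] (p : RepHU G) : (repCategory G).real :=
  Quot.lift (fun q : EU p.1 × RepSpace G p.1 => (orbitFunctor q.2).real q.1) (by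
    rintro ⟨e, ρ⟩ _ ⟨g, rfl⟩
    exact (orbitFunctor_rightMul g ρ e).symm) p.2

theorem alpha_mk {n : ℕ} {k : ℕ} (x : Chain (translation n) k)
    (t : stdSimplex ℝ (Fin (k + 1))) (ρ : RepSpace G n) :
    alpha G (RepHU.mk (TopCategory.pt x t) ρ) =
      TopCategory.pt ((orbitFunctor ρ).mapChain x) t := rfl

end

end DefK

namespace DefK

noncomputable section

open CategoryTheory Opposite

universe u w

/-! In each simplicial degree `α` is a normal form for orbits. A simplex of the nerve of `R(G)` in
dimension `n` has an initial representation `ρ` and matrices `Aᵢ` of its arrows `0 → i`; its arrow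
`i → j` is then forced to be `Aⱼ Aᵢ⁻¹`. So it is the image of `((Aᵢ), ρ)` with `A₀ = 1`, and an
arbitrary `((Bᵢ), ψ)` is moved to this form by exactly one group element, `B₀⁻¹`. Taking the
matrices of the arrows `0 → i` therefore defines the inverse `unorbit` (`mapChain_startChain`,
`unorbitAt_mapChain`). Multiplicativity is checked on representatives with common simplex
coordinates.

The work is in the topology, because all products carry the ordinary product topology and a product
of quotient maps need not be a quotient map. The inverse causes no trouble: it is given by
continuous formulas on cells, and dimension is locally constant. For `α` itself, `Hom(G, U(n))` is
compact Hausdorff, so taking the product with it respects the weak topology of `EU(n)`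
(`Realization.continuous_of_prod_left`).

For the multiplication of `Rep(G)_{hU}`, one needs `EU(n) × EU(m)` to have the weak topology of the
products of its pieces. This holds because `U(n)` is compact: `EU(n)` is an increasing union of
quotients of compact Hausdorff spaces by closed equivalence relations, and for two such unions open
rectangles can be built stage by stage with the tube lemma (`IsCompactFiltration.isOpen_prod`). The
orbit maps are open, so they cause no further difficulty. Continuity of the multiplication of
`|R(G)|` is then transported along `α`. -/

/-! ### Products of increasing unions of compact spaces -/

/-- The space `X` is the increasing union of the images of maps `q k : S k → X`, has the weak topology
with respect to these maps, and saturations of closed subsets of `S k` are closed. -/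
structure IsCompactFiltration {X : Type*} [TopologicalSpace X] {S : ℕ → Type*}
    [∀ k, TopologicalSpace (S k)] (q : ∀ k, S k → X) : Prop where
  isOpen_iff : ∀ V : Set X, IsOpen V ↔ ∀ k, IsOpen (q k ⁻¹' V)
  cover : ∀ x, ∃ k, x ∈ Set.range (q k)
  lift : ∀ k, ∃ j : S k → S (k + 1), Continuous j ∧ ∀ a, q (k + 1) (j a) = q k a
  closed : ∀ k (F : Set (S k)), IsClosed F → IsClosed (q k ⁻¹' (q k '' F))

namespace IsCompactFiltration

variable {X Y : Type*} [TopologicalSpace X] [TopologicalSpace Y] {S T : ℕ → Type*}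
  [∀ k, TopologicalSpace (S k)] [∀ k, TopologicalSpace (T k)] {q : ∀ k, S k → X} {p : ∀ k, T k → Y}

theorem lift_le (hq : IsCompactFiltration q) {k m : ℕ} (h : k ≤ m) :
    ∃ j : S k → S m, Continuous j ∧ ∀ a, q m (j a) = q k a := by
  induction m, h using Nat.le_induction with
  | base => exact ⟨id, continuous_id, fun _ => rfl⟩
  | succ m _ ih =>
    obtain ⟨j, hj, h⟩ := ih
    obtain ⟨j', hj', h'⟩ := hq.lift m
    exact ⟨j' ∘ j, hj'.comp hj, fun a => (h' _).trans (h a)⟩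

theorem isOpen_preimage_of_le (hq : IsCompactFiltration q) {k m : ℕ} (h : k ≤ m) {V : Set X}
    (hV : IsOpen (q m ⁻¹' V)) : IsOpen (q k ⁻¹' V) := by
  obtain ⟨j, hj, hjq⟩ := hq.lift_le h
  convert hV.preimage hj using 1
  ext a
  simp [hjq]

theorem range_subset (hq : IsCompactFiltration q) {k m : ℕ} (h : k ≤ m) :
    Set.range (q k) ⊆ Set.range (q m) := by
  obtain ⟨j, hj, hjq⟩ := hq.lift_le h
  rintro _ ⟨a, rfl⟩
  exact ⟨j a, hjq a⟩

/-- The part of `S k` over `A` is compact, so its image in `S (k + 1)` is closed, and the preimage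
of `A` there is the saturation of that image. -/
theorem isClosed_preimage_succ (hq : IsCompactFiltration q) [∀ k, CompactSpace (S k)]
    [∀ k, T2Space (S k)] {k : ℕ} {A : Set X} (hA : A ⊆ Set.range (q k))
    (hc : IsClosed (q k ⁻¹' A)) : IsClosed (q (k + 1) ⁻¹' A) := by
  obtain ⟨j, hj, hjq⟩ := hq.lift k
  have h : A = q (k + 1) '' (j '' (q k ⁻¹' A)) := by
    rw [Set.image_image]
    simp only [hjq]
    rw [Set.image_preimage_eq_of_subset hA]
  rw [h]
  exact hq.closed _ _ (hc.isCompact.image hj).isClosed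

/-- A saturated neighbourhood between a closed saturated set and an open set. -/
theorem exists_between (hq : IsCompactFiltration q) [∀ k, CompactSpace (S k)]
    [∀ k, T2Space (S k)] {k : ℕ} {A : Set X} (hA : A ⊆ Set.range (q k))
    (hc : IsClosed (q k ⁻¹' A)) {O : Set (S k)} (hO : IsOpen O) (hAO : q k ⁻¹' A ⊆ O) :
    ∃ V B : Set X, IsOpen (q k ⁻¹' V) ∧ IsClosed (q k ⁻¹' B) ∧ A ⊆ V ∧ V ⊆ B ∧
      B ⊆ Set.range (q k) ∧ q k ⁻¹' B ⊆ O := by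
  -- The largest saturated subset of an open set is the complement of the saturation of its
  -- complement. It is open by `closed`, and it still contains the saturated set `q k ⁻¹' A`.
  have key : ∀ {O : Set (S k)}, IsOpen O → q k ⁻¹' A ⊆ O →
      IsOpen (q k ⁻¹' (q k '' Oᶜ))ᶜ ∧ q k ⁻¹' A ⊆ (q k ⁻¹' (q k '' Oᶜ))ᶜ := by
    intro O hO hAO
    refine ⟨(hq.closed k _ hO.isClosed_compl).isOpen_compl, ?_⟩
    rintro a ha ⟨b, hb, hba⟩
    refine hb (hAO ?_)
    rw [Set.mem_preimage, hba]
    exact ha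
  -- Shrinking to saturated subsets before and after applying normality makes `V` open at stage `k`
  -- and keeps `closure O'` away from the saturation of `Oᶜ`; hence the saturation of `closure O'`,
  -- which is the preimage of `B`, stays inside `O`.
  obtain ⟨h1, h2⟩ := key hO hAO
  obtain ⟨O', hO', hAO', hcl⟩ := normal_exists_closure_subset hc h1 h2
  obtain ⟨h3, h4⟩ := key hO' hAO'
  have hVO : (q k ⁻¹' (q k '' O'ᶜ))ᶜ ⊆ O' := by
    intro a ha
    by_contra h
    exact ha ⟨a, h, rfl⟩
  refine ⟨q k '' (q k ⁻¹' (q k '' O'ᶜ))ᶜ, q k '' closure O', ?_, hq.closed k _ isClosed_closure,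
    ?_, Set.image_mono (hVO.trans subset_closure), Set.image_subset_range _ _, ?_⟩
  · convert h3 using 1
    ext a
    constructor
    · rintro ⟨b, hb, hba⟩ ⟨c, hc, hca⟩
      exact hb ⟨c, hc, hca.trans hba.symm⟩
    · exact fun h => ⟨a, h, rfl⟩
  · rw [← Set.image_preimage_eq_of_subset hA]
    exact Set.image_mono h4
  · rintro a ⟨b, hb, hba⟩
    by_contra h
    exact hcl hb ⟨a, h, hba.symm⟩

/-- The inductive step for `isOpen_prod`: the tube lemma gives an open rectangle around the compact
one, and each side is thickened inside it by `exists_between`. The sets `V`, `V'` are open only at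
stage `k`; the closed sets `A'`, `B'` containing them are what the next stage thickens again. -/
theorem isOpen_prod_aux (hq : IsCompactFiltration q) (hp : IsCompactFiltration p)
    [∀ k, CompactSpace (S k)] [∀ k, T2Space (S k)] [∀ k, CompactSpace (T k)] [∀ k, T2Space (T k)]
    {W : Set (X × Y)} {k : ℕ} (hW : IsOpen (Prod.map (q k) (p k) ⁻¹' W)) {A : Set X} {B : Set Y}
    (hA : A ⊆ Set.range (q k)) (hAc : IsClosed (q k ⁻¹' A))
    (hB : B ⊆ Set.range (p k)) (hBc : IsClosed (p k ⁻¹' B)) (hAB : A ×ˢ B ⊆ W) :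
    ∃ (A' : Set X) (B' : Set Y) (V : Set X) (V' : Set Y),
      A' ⊆ Set.range (q k) ∧ IsClosed (q k ⁻¹' A') ∧ B' ⊆ Set.range (p k) ∧
      IsClosed (p k ⁻¹' B') ∧ A' ×ˢ B' ⊆ W ∧ A ⊆ V ∧ V ⊆ A' ∧ B ⊆ V' ∧ V' ⊆ B' ∧
      IsOpen (q k ⁻¹' V) ∧ IsOpen (p k ⁻¹' V') := by
  obtain ⟨O, O', hO, hO', hAO, hBO, hOW⟩ := generalized_tube_lemma hAc.isCompact hBc.isCompact hW
    (fun x hx => hAB ⟨hx.1, hx.2⟩)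
  obtain ⟨V, A', h1, h2, h3, h4, h5, h6⟩ := hq.exists_between hA hAc hO hAO
  obtain ⟨V', B', h1', h2', h3', h4', h5', h6'⟩ := hp.exists_between hB hBc hO' hBO
  refine ⟨A', B', V, V', h5, h2, h5', h2', ?_, h3, h4, h3', h4', h1, h1'⟩
  rintro ⟨x, y⟩ ⟨hx, hy⟩
  obtain ⟨a, rfl⟩ := h5 hx
  obtain ⟨b, rfl⟩ := h5' hy
  exact hOW (Set.mk_mem_prod (h6 hx) (h6' hy))

/-- The product of two increasing unions of compact spaces has the weak topology with respect to the
products of the pieces. -/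
theorem isOpen_prod (hq : IsCompactFiltration q) (hp : IsCompactFiltration p)
    [∀ k, CompactSpace (S k)] [∀ k, T2Space (S k)] [∀ k, CompactSpace (T k)] [∀ k, T2Space (T k)]
    {W : Set (X × Y)} (hW : ∀ k, IsOpen (Prod.map (q k) (p k) ⁻¹' W)) : IsOpen W := by
  rw [isOpen_prod_iff]
  intro x y hxy
  obtain ⟨k, hx, hy⟩ : ∃ k, x ∈ Set.range (q k) ∧ y ∈ Set.range (p k) := by
    obtain ⟨k, hk⟩ := hq.cover x
    obtain ⟨l, hl⟩ := hp.cover y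
    exact ⟨max k l, hq.range_subset (le_max_left _ _) hk, hp.range_subset (le_max_right _ _) hl⟩
  -- The invariant of the construction: a rectangle inside `W` whose sides lie in stage `k + n` and
  -- are closed there.
  let P : ℕ → Set X × Set Y → Prop := fun n A =>
    A.1 ⊆ Set.range (q (k + n)) ∧ IsClosed (q (k + n) ⁻¹' A.1) ∧
    A.2 ⊆ Set.range (p (k + n)) ∧ IsClosed (p (k + n) ⁻¹' A.2) ∧ A.1 ×ˢ A.2 ⊆ W
  have step : ∀ n (A : {A // P n A}), ∃ A' : {A // P (n + 1) A}, ∃ (V : Set X) (V' : Set Y),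
      A.1.1 ⊆ V ∧ V ⊆ A'.1.1 ∧ A.1.2 ⊆ V' ∧ V' ⊆ A'.1.2 ∧
      IsOpen (q (k + (n + 1)) ⁻¹' V) ∧ IsOpen (p (k + (n + 1)) ⁻¹' V') := by
    rintro n ⟨⟨A, B⟩, h1, h2, h3, h4, h5⟩
    obtain ⟨A', B', V, V', g1, g2, g3, g4, g5, g⟩ := isOpen_prod_aux hq hp (hW (k + (n + 1)))
      (h1.trans (hq.range_subset (by omega))) (hq.isClosed_preimage_succ h1 h2)
      (h3.trans (hp.range_subset (by omega))) (hp.isClosed_preimage_succ h3 h4) h5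
    exact ⟨⟨(A', B'), g1, g2, g3, g4, g5⟩, V, V', g⟩
  choose f V V' hV hV1 hV' hV1' hVo hVo' using step
  obtain ⟨a, rfl⟩ := hx
  obtain ⟨b, rfl⟩ := hy
  have h0 : P 0 ({q k a}, {p k b}) := by
    have ha := hq.closed k {a}
    have hb := hp.closed k {b}
    rw [Set.image_singleton] at ha hb
    refine ⟨by simp, ha isClosed_singleton, by simp, hb isClosed_singleton, ?_⟩
    rintro ⟨x', y'⟩ ⟨hx', hy'⟩
    simp only [Set.mem_singleton_iff] at hx' hy'
    rw [hx', hy']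
    exact hxy
  let s : ∀ n, {A // P n A} := fun n => Nat.rec ⟨_, h0⟩ (fun n A => f n A) n
  have hs : ∀ n, s (n + 1) = f n (s n) := fun _ => rfl
  have mono : Monotone fun n => (s n).1.1 := monotone_nat_of_le_succ fun n =>
    (hV n (s n)).trans (hV1 n (s n))
  have mono' : Monotone fun n => (s n).1.2 := monotone_nat_of_le_succ fun n =>
    (hV' n (s n)).trans (hV1' n (s n))
  refine ⟨⋃ n, (s n).1.1, ⋃ n, (s n).1.2, ?_, ?_, Set.mem_iUnion.2 ⟨0, rfl⟩,
    Set.mem_iUnion.2 ⟨0, rfl⟩, ?_⟩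
  · rw [hq.isOpen_iff]
    intro m
    -- To test openness at stage `m`, the early sets are discarded: the sets `V n` are interleaved
    -- with the increasing closed sets, and those with `m ≤ n` are open at a stage beyond `m`, hence
    -- also at stage `m`.
    have : (⋃ n, (s n).1.1) = ⋃ n : {n : ℕ // m ≤ n}, V n (s n) := by
      refine Set.Subset.antisymm (Set.iUnion_subset fun n => ?_) (Set.iUnion_subset fun n => ?_)
      · exact (mono (le_max_left n m)).trans ((hV _ _).trans
          (Set.subset_iUnion_of_subset ⟨max n m, le_max_right n m⟩ subset_rfl))
      · exact (hV1 _ _).trans (Set.subset_iUnion (fun n => (s n).1.1) (n + 1))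
    rw [this, Set.preimage_iUnion]
    exact isOpen_iUnion fun n => hq.isOpen_preimage_of_le (by have := n.2; omega) (hVo _ _)
  · rw [hp.isOpen_iff]
    intro m
    have : (⋃ n, (s n).1.2) = ⋃ n : {n : ℕ // m ≤ n}, V' n (s n) := by
      refine Set.Subset.antisymm (Set.iUnion_subset fun n => ?_) (Set.iUnion_subset fun n => ?_)
      · exact (mono' (le_max_left n m)).trans ((hV' _ _).trans
          (Set.subset_iUnion_of_subset ⟨max n m, le_max_right n m⟩ subset_rfl))
      · exact (hV1' _ _).trans (Set.subset_iUnion (fun n => (s n).1.2) (n + 1))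
    rw [this, Set.preimage_iUnion]
    exact isOpen_iUnion fun n => hp.isOpen_preimage_of_le (by have := n.2; omega) (hVo' _ _)
  · rintro ⟨x', y'⟩ ⟨hx', hy'⟩
    obtain ⟨n, hn⟩ := Set.mem_iUnion.1 hx'
    obtain ⟨m, hm⟩ := Set.mem_iUnion.1 hy'
    exact (s (max n m)).2.2.2.2.2 ⟨mono (le_max_left _ _) hn, mono' (le_max_right _ _) hm⟩

end IsCompactFiltration

/-! ### Common refinements of bounded dimension -/

/-- A refinement with `r` minimal has no two consecutive sample points at which both step functions
agree, since such points could be merged. Hence the sum of the two step values strictly increases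
along the samples, and it ends at most at `k + l`. The bound leaves only finitely many pairs of
simplicial operators to consider, which the compactness arguments need. -/
theorem exists_common_le {k l : ℕ} (s : stdSimplex ℝ (Fin (k + 1)))
    (t : stdSimplex ℝ (Fin (l + 1))) :
    ∃ (r : ℕ) (c : Fin (r + 1) →o Set.Ico (0 : ℝ) 1) (v : stdSimplex ℝ (Fin (r + 1))),
      r ≤ k + l ∧ stdSimplex.map (sampleHom s c).toOrderHom v = s ∧
      stdSimplex.map (sampleHom t c).toOrderHom v = t := by
  classical
  have hex := exists_common s t
  obtain ⟨c, v, hs, ht⟩ := Nat.find_spec hex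
  have hmin := fun {m} => Nat.find_min (m := m) hex
  generalize Nat.find hex = r at c v hs ht hmin
  refine ⟨r, c, v, ?_, hs, ht⟩
  have hlt : ∀ i : Fin r, (step s (c i.castSucc) : ℕ) + step t (c i.castSucc) <
      step s (c i.succ) + step t (c i.succ) := by
    intro i
    by_contra hcon
    have hsi : step s (c i.castSucc) ≤ step s (c i.succ) :=
      step_mono s (c.monotone (Fin.castSucc_le_succ i))
    have hti : step t (c i.castSucc) ≤ step t (c i.succ) :=
      step_mono t (c.monotone (Fin.castSucc_le_succ i))
    have es : step s (c i.castSucc) = step s (c i.succ) := by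
      rw [Fin.le_def] at hsi hti; ext; omega
    have et : step t (c i.castSucc) = step t (c i.succ) := by
      rw [Fin.le_def] at hsi hti; ext; omega
    obtain ⟨r, rfl⟩ := Nat.exists_eq_succ_of_ne_zero (Nat.ne_of_gt (Fin.pos i))
    -- Delete the sample point with index `i.succ` and add its weight to that of `i.castSucc`.
    have fac : ∀ {m : ℕ} (w : stdSimplex ℝ (Fin (m + 1))),
        step w (c i.castSucc) = step w (c i.succ) →
        stdSimplex.map (sampleHom w c).toOrderHom v = w →
        stdSimplex.map (sampleHom w (c.comp (Fin.succAboveOrderEmb i.succ).toOrderHom)).toOrderHom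
          (stdSimplex.map (Fin.predAbove i) v) = w := by
      intro m w hw h
      rw [stdSimplex.map_comp_apply]
      conv_rhs => rw [← h]
      congr 1
      funext j
      change step w (c (i.succ.succAbove (i.predAbove j))) = step w (c j)
      by_cases hj : j = i.succ
      · rw [hj, Fin.predAbove_succ_self, Fin.succAbove_succ_self, hw]
      · rw [Fin.succ_succAbove_predAbove hj]
    exact hmin (Nat.lt_succ_self r) ⟨_, _, fac s es hs, fac t et ht⟩
  have hge : ∀ i : Fin (r + 1), (i : ℕ) ≤ step s (c i) + step t (c i) := by
    intro i
    induction i using Fin.induction with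
    | zero => simp
    | succ i ih => have := hlt i; simp only [Fin.val_castSucc, Fin.val_succ] at ih ⊢; omega
  have h := hge (Fin.last r)
  have h1 := (step s (c (Fin.last r))).is_le
  have h2 := (step t (c (Fin.last r))).is_le
  rw [Fin.val_last] at h
  omega

/-! ### Realizations of levelwise compact simplicial spaces -/

/-- The monotone map `θ` as a morphism of the simplex category. -/
abbrev opHom {k l : ℕ} (θ : Fin (k + 1) →o Fin (l + 1)) :
    op (SimplexCategory.mk l) ⟶ op (SimplexCategory.mk k) :=
  (SimplexCategory.mkHom θ).op

namespace Realization

/-- The characteristic map `Xₖ × Δᵏ → |X|`. -/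
def cell (X : SimplicialObject TopCat.{u}) (k : ℕ)
    (p : X.obj (op (SimplexCategory.mk k)) × stdSimplex ℝ (Fin (k + 1))) : Realization X :=
  mk p.1 p.2

theorem isOpen_iff {X : SimplicialObject TopCat.{u}} {V : Set (Realization X)} :
    IsOpen V ↔ ∀ k, IsOpen (cell X k ⁻¹' V) := by
  change IsOpen (Quot.mk (CellRel X) ⁻¹' V) ↔ _
  rw [isOpen_sigma_iff]
  rfl

theorem continuous_cell (X : SimplicialObject TopCat.{u}) (k : ℕ) : Continuous (cell X k) :=
  continuous_def.2 fun _ h => isOpen_iff.1 h k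

theorem continuous_iff {X : SimplicialObject TopCat.{u}} {Z : Type*} [TopologicalSpace Z]
    {f : Realization X → Z} : Continuous f ↔ ∀ k, Continuous fun p => f (cell X k p) := by
  refine ⟨fun h k => h.comp (continuous_cell X k), fun h => continuous_def.2 fun V hV => ?_⟩
  exact isOpen_iff.2 fun k => hV.preimage (h k)

/-- Sampling is well defined on `|X|`, so equal points have equal samples along a common refinement.
This replaces the generated equivalence relation by finitely many explicit conditions. -/
theorem mk_eq_mk_iff {X : SimplicialObject TopCat.{u}} {k l : ℕ}
    {x : X.obj (op (SimplexCategory.mk k))} {s : stdSimplex ℝ (Fin (k + 1))}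
    {y : X.obj (op (SimplexCategory.mk l))} {t : stdSimplex ℝ (Fin (l + 1))} :
    mk x s = mk y t ↔ ∃ (r : Fin (k + l + 1)) (θ : Fin ((r : ℕ) + 1) →o Fin (k + 1))
      (η : Fin ((r : ℕ) + 1) →o Fin (l + 1)) (v : stdSimplex ℝ (Fin ((r : ℕ) + 1))),
      X.map (opHom θ) x = X.map (opHom η) y ∧ stdSimplex.map θ v = s ∧ stdSimplex.map η v = t := by
  constructor
  · intro h
    obtain ⟨r, c, v, hr, hs, ht⟩ := exists_common_le s t
    exact ⟨⟨r, Nat.lt_succ_of_le hr⟩, (sampleHom s c).toOrderHom, (sampleHom t c).toOrderHom, v,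
      congrArg (sample c) h, hs, ht⟩
  · rintro ⟨r, θ, η, v, h, rfl, rfl⟩
    have h1 := glue (SimplexCategory.mkHom θ) x v
    have h2 := glue (SimplexCategory.mkHom η) y v
    exact h1.trans ((congrArg (fun z => mk z v) h).trans h2.symm)

/-- By `mk_eq_mk_iff` the relation is a finite union, over pairs of operators, of continuous images
of closed subsets of compact spaces. -/
theorem isClosed_ker (X : SimplicialObject TopCat.{u})
    [∀ k, CompactSpace (X.obj (op (SimplexCategory.mk k)))]
    [∀ k, T2Space (X.obj (op (SimplexCategory.mk k)))] (k : ℕ) :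
    IsClosed {p : (X.obj (op (SimplexCategory.mk k)) × stdSimplex ℝ (Fin (k + 1))) ×
      (X.obj (op (SimplexCategory.mk k)) × stdSimplex ℝ (Fin (k + 1))) |
        cell X k p.1 = cell X k p.2} := by
  have h : {p : (X.obj (op (SimplexCategory.mk k)) × stdSimplex ℝ (Fin (k + 1))) ×
      (X.obj (op (SimplexCategory.mk k)) × stdSimplex ℝ (Fin (k + 1))) |
        cell X k p.1 = cell X k p.2} =
      ⋃ (r : Fin (k + k + 1)), ⋃ (θ : Fin ((r : ℕ) + 1) →o Fin (k + 1)),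
      ⋃ (η : Fin ((r : ℕ) + 1) →o Fin (k + 1)),
      (fun z : (X.obj (op (SimplexCategory.mk k)) × X.obj (op (SimplexCategory.mk k))) ×
          stdSimplex ℝ (Fin ((r : ℕ) + 1)) =>
        ((z.1.1, stdSimplex.map θ z.2), (z.1.2, stdSimplex.map η z.2))) ''
        {z | X.map (opHom θ) z.1.1 = X.map (opHom η) z.1.2} := by
    ext ⟨⟨x, s⟩, ⟨y, t⟩⟩
    simp only [Set.mem_ofPred_eq, cell, mk_eq_mk_iff, Set.mem_iUnion, Set.mem_image]
    constructor
    · rintro ⟨r, θ, η, v, h, rfl, rfl⟩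
      exact ⟨r, θ, η, ((x, y), v), h, rfl⟩
    · rintro ⟨r, θ, η, ⟨⟨x', y'⟩, v⟩, h, h'⟩
      simp only [Prod.mk.injEq] at h'
      obtain ⟨⟨rfl, rfl⟩, rfl, rfl⟩ := h'
      exact ⟨r, θ, η, v, h, rfl, rfl⟩
  rw [h]
  have fin : ∀ m n : ℕ, Finite (Fin m →o Fin n) := fun m n => DFunLike.finite _
  refine isClosed_iUnion_of_finite fun r => isClosed_iUnion_of_finite fun θ =>
    isClosed_iUnion_of_finite fun η => ?_
  have hθ := stdSimplex.continuous_map (S := ℝ) θ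
  have hη := stdSimplex.continuous_map (S := ℝ) η
  refine (IsCompact.image (IsClosed.isCompact (isClosed_eq ?_ ?_)) ?_).isClosed
  · exact (X.map (opHom θ)).hom.continuous.comp (continuous_fst.comp continuous_fst)
  · exact (X.map (opHom η)).hom.continuous.comp (continuous_snd.comp continuous_fst)
  · exact ((continuous_fst.comp continuous_fst).prodMk (hθ.comp continuous_snd)).prodMk
      ((continuous_snd.comp continuous_fst).prodMk (hη.comp continuous_snd))

theorem isCompactFiltration (X : SimplicialObject TopCat.{u})
    [∀ k, CompactSpace (X.obj (op (SimplexCategory.mk k)))]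
    [∀ k, T2Space (X.obj (op (SimplexCategory.mk k)))] : IsCompactFiltration (cell X) where
  isOpen_iff _ := isOpen_iff
  cover x := by
    obtain ⟨k, y, t, rfl⟩ := x.exists_rep
    exact ⟨k, (y, t), rfl⟩
  lift k := by
    -- The degeneracy repeating the last vertex; `Fin.castSucc` is a section of it, so the
    -- degenerate simplex at the included coordinates represents the same point.
    let σ : Fin (k + 1 + 1) →o Fin (k + 1) := ⟨Fin.predAbove (Fin.last k),
      Fin.predAbove_right_monotone _⟩
    have hσ : ∀ i : Fin (k + 1), σ i.castSucc = i := fun i => Fin.predAbove_castSucc_of_le _ _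
      (Fin.le_last i)
    refine ⟨fun p => (X.map (opHom σ) p.1, stdSimplex.map Fin.castSucc p.2), ?_, ?_⟩
    · exact ((X.map (opHom σ)).hom.continuous.comp continuous_fst).prodMk
        ((stdSimplex.continuous_map _).comp continuous_snd)
    · rintro ⟨x, t⟩
      have h := glue (SimplexCategory.mkHom σ) x (stdSimplex.map Fin.castSucc t)
      refine h.symm.trans ?_
      have h2 : stdSimplex.map (SimplexCategory.mkHom σ).toOrderHom
          (stdSimplex.map Fin.castSucc t) = t := by
        rw [stdSimplex.map_comp_apply]
        have : ((SimplexCategory.mkHom σ).toOrderHom : Fin (k + 1 + 1) → Fin (k + 1)) ∘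
          Fin.castSucc = id := funext hσ
        rw [this, stdSimplex.map_id_apply]
      rw [h2]
      rfl
  closed k F hF := by
    -- The saturation of `F` is a projection of a closed subset of the kernel relation, and the
    -- projection is along a compact factor.
    have h : cell X k ⁻¹' (cell X k '' F) = Prod.snd '' ({p | cell X k p.1 = cell X k p.2} ∩
        Prod.fst ⁻¹' F) := by
      ext b
      constructor
      · rintro ⟨a, ha, hab⟩
        exact ⟨(a, b), ⟨hab, ha⟩, rfl⟩
      · rintro ⟨⟨a, b⟩, ⟨hab, ha⟩, rfl⟩
        exact ⟨a, ha, hab⟩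
    rw [h]
    exact (((isClosed_ker X k).inter (hF.preimage continuous_fst)).isCompact.image
      continuous_snd).isClosed

/-- A function on `|X| × |Y|` is continuous if it is so on each `Xᵣ × Yᵣ × Δʳ`. -/
theorem continuous_of_prod {X Y : SimplicialObject TopCat.{u}}
    [∀ k, CompactSpace (X.obj (op (SimplexCategory.mk k)))]
    [∀ k, T2Space (X.obj (op (SimplexCategory.mk k)))]
    [∀ k, CompactSpace (Y.obj (op (SimplexCategory.mk k)))]
    [∀ k, T2Space (Y.obj (op (SimplexCategory.mk k)))] {Z : Type*} [TopologicalSpace Z]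
    {f : Realization X × Realization Y → Z}
    (hf : ∀ r : ℕ, Continuous fun p : (X.obj (op (SimplexCategory.mk r)) ×
      Y.obj (op (SimplexCategory.mk r))) × stdSimplex ℝ (Fin (r + 1)) =>
        f (mk p.1.1 p.2, mk p.1.2 p.2)) : Continuous f := by
  have key : ∀ k, Continuous (f ∘ Prod.map (cell X k) (cell Y k)) := by
    intro k
    have fin : ∀ m n : ℕ, Finite (Fin m →o Fin n) := fun m n => DFunLike.finite _
    let I : Type := Σ r : Fin (k + k + 1), (Fin ((r : ℕ) + 1) →o Fin (k + 1)) ×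
      (Fin ((r : ℕ) + 1) →o Fin (k + 1))
    -- Pairs of points of `Δᵏ` are covered by finitely many simplices, as in the triangulation of
    -- `Δᵏ × Δᵏ`. The map `P` is a surjection from a compact space onto a Hausdorff one, hence a
    -- quotient map.
    let P : (Σ i : I, (X.obj (op (SimplexCategory.mk k)) × Y.obj (op (SimplexCategory.mk k))) ×
        stdSimplex ℝ (Fin ((i.1 : ℕ) + 1))) →
        (X.obj (op (SimplexCategory.mk k)) × stdSimplex ℝ (Fin (k + 1))) ×
        (Y.obj (op (SimplexCategory.mk k)) × stdSimplex ℝ (Fin (k + 1))) := fun z =>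
      ((z.2.1.1, stdSimplex.map z.1.2.1 z.2.2), (z.2.1.2, stdSimplex.map z.1.2.2 z.2.2))
    have hP : Continuous P := by
      refine continuous_sigma fun i => ?_
      have hθ := stdSimplex.continuous_map (S := ℝ) i.2.1
      have hη := stdSimplex.continuous_map (S := ℝ) i.2.2
      exact ((continuous_fst.comp continuous_fst).prodMk (hθ.comp continuous_snd)).prodMk
        ((continuous_snd.comp continuous_fst).prodMk (hη.comp continuous_snd))
    have hsurj : Function.Surjective P := by
      rintro ⟨⟨x, s⟩, ⟨y, t⟩⟩
      obtain ⟨r, c, v, hr, hs, ht⟩ := exists_common_le s t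
      refine ⟨⟨⟨⟨r, Nat.lt_succ_of_le hr⟩, (sampleHom s c).toOrderHom,
        (sampleHom t c).toOrderHom⟩, (x, y), v⟩, ?_⟩
      exact Prod.ext (Prod.ext rfl hs) (Prod.ext rfl ht)
    have : Finite I := inferInstanceAs (Finite (Σ _, _))
    refine (Topology.IsQuotientMap.of_surjective_continuous hsurj hP).continuous_iff.2
      (continuous_sigma fun i => ?_)
    have h : (fun z => f (Prod.map (cell X k) (cell Y k) (P ⟨i, z⟩))) = fun z =>
        f (mk (X.map (opHom i.2.1) z.1.1) z.2, mk (Y.map (opHom i.2.2) z.1.2) z.2) := by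
      funext z
      exact congrArg f (Prod.ext (glue (SimplexCategory.mkHom i.2.1) z.1.1 z.2)
        (glue (SimplexCategory.mkHom i.2.2) z.1.2 z.2))
    change Continuous fun z => f (Prod.map (cell X k) (cell Y k) (P ⟨i, z⟩))
    rw [h]
    exact (hf i.1).comp ((((X.map (opHom i.2.1)).hom.continuous.comp
      (continuous_fst.comp continuous_fst)).prodMk ((Y.map (opHom i.2.2)).hom.continuous.comp
      (continuous_snd.comp continuous_fst))).prodMk continuous_snd)
  exact continuous_def.2 fun V hV => (isCompactFiltration X).isOpen_prod (isCompactFiltration Y)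
    fun k => hV.preimage (key k)

/-- A function on `|X| × Y`, with `Y` locally compact, is continuous if it is so on each
`Xₖ × Δᵏ × Y`. -/
theorem continuous_of_prod_left {X : SimplicialObject TopCat.{u}} {Y Z : Type*}
    [TopologicalSpace Y] [LocallyCompactSpace Y] [TopologicalSpace Z] {f : Realization X × Y → Z}
    (hf : ∀ k, Continuous fun p : (X.obj (op (SimplexCategory.mk k)) ×
      stdSimplex ℝ (Fin (k + 1))) × Y => f (cell X k p.1, p.2)) : Continuous f := by
  have h : ∀ e, Continuous fun y => f (e, y) := by
    intro e
    obtain ⟨k, x, t, rfl⟩ := e.exists_rep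
    exact (hf k).comp (Continuous.prodMk_right (x, t))
  -- By currying, continuity into the compact-open topology is tested on cells; local compactness of
  -- `Y` allows uncurrying.
  let F : Realization X → C(Y, Z) := fun e => ⟨_, h e⟩
  have hF : Continuous F := Realization.continuous_iff.2 fun k =>
    ContinuousMap.continuous_of_continuous_uncurry _ (hf k)
  exact ContinuousMap.continuous_uncurry_of_continuous ⟨F, hF⟩

end Realization

/-! ### Functors and realization -/

theorem Chain.continuous_mor {C : TopCategory.{u}} {k : ℕ} (i j : Fin (k + 1)) (h : i ≤ j) :
    Continuous fun s : Chain C k => s.mor i j h := by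
  have h1 : Continuous fun s : Chain C k => (s.obj,
      fun p : {p : Fin (k + 1) × Fin (k + 1) // p.1 ≤ p.2} => s.mor p.1.1 p.1.2 p.2) :=
    continuous_induced_dom
  exact (continuous_apply (⟨(i, j), h⟩ : {p : Fin (k + 1) × Fin (k + 1) // p.1 ≤ p.2})).comp h1.snd

theorem Chain.continuous_obj {C : TopCategory.{u}} {k : ℕ} (i : Fin (k + 1)) :
    Continuous fun s : Chain C k => s.obj i := by
  have h1 : Continuous fun s : Chain C k => (s.obj,
      fun p : {p : Fin (k + 1) × Fin (k + 1) // p.1 ≤ p.2} => s.mor p.1.1 p.1.2 p.2) :=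
    continuous_induced_dom
  exact (continuous_apply i).comp h1.fst

/-- A map to the space of simplices of a nerve is continuous if its morphism components are. -/
theorem Chain.continuous_rng {C : TopCategory.{u}} {k : ℕ} {Z : Type*} [TopologicalSpace Z]
    {f : Z → Chain C k} (h : ∀ i j hij, Continuous fun z => (f z).mor i j hij) : Continuous f := by
  refine continuous_induced_rng.2 (Continuous.prodMk (continuous_pi fun i => ?_)
    (continuous_pi fun p => h _ _ _))
  have h1 : (fun z => (f z).obj i) = fun z => C.dom ((f z).mor i i le_rfl) :=
    funext fun z => ((f z).dom_mor i i le_rfl).symm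
  change Continuous fun z => (f z).obj i
  rw [h1]
  exact C.continuous_dom.comp (h i i le_rfl)

instance {C : TopCategory.{u}} {k : ℕ} [T2Space C.Mor] : T2Space (Chain C k) := by
  refine T2Space.of_injective_continuous (f := fun s : Chain C k =>
    fun p : {p : Fin (k + 1) × Fin (k + 1) // p.1 ≤ p.2} => s.mor p.1.1 p.1.2 p.2) ?_ ?_
  · exact fun x y h => Chain.ext_mor fun i j hij => congrFun h ⟨(i, j), hij⟩
  · exact continuous_pi fun p => Chain.continuous_mor _ _ _

theorem TopFunctor.continuous_mapChain {C : TopCategory.{u}} {D : TopCategory.{w}}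
    (F : TopFunctor C D) {k : ℕ} : Continuous fun s : Chain C k => F.mapChain s :=
  Chain.continuous_rng fun i j h => F.continuous_mor.comp (Chain.continuous_mor i j h)

theorem TopCategory.continuous_pt {C : TopCategory.{u}} (k : ℕ) :
    Continuous fun p : Chain C k × stdSimplex ℝ (Fin (k + 1)) => pt p.1 p.2 :=
  Realization.continuous_cell C.nerve k

theorem TopFunctor.continuous_real {C : TopCategory.{u}} {D : TopCategory.{w}}
    (F : TopFunctor C D) : Continuous F.real :=
  Realization.continuous_iff.2 fun k => (TopCategory.continuous_pt k).comp
    ((F.continuous_mapChain.comp continuous_fst).prodMk continuous_snd)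

theorem Chain.continuous_prod {C D : TopCategory.{u}} {k : ℕ} :
    Continuous fun p : Chain C k × Chain D k => p.1.prod p.2 :=
  Chain.continuous_rng fun i j h => ((Chain.continuous_mor i j h).comp continuous_fst).prodMk
    ((Chain.continuous_mor i j h).comp continuous_snd)

/-- The pairing of classifying spaces induced by a functor of two variables is continuous when the
spaces of simplices are compact Hausdorff. -/
theorem TopFunctor.continuous_real₂ {C D : TopCategory.{u}} {E : TopCategory.{w}}
    (F : TopFunctor (C.prod D) E) [hC : ∀ k, CompactSpace (Chain C k)]
    [hC' : ∀ k, T2Space (Chain C k)] [hD : ∀ k, CompactSpace (Chain D k)]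
    [hD' : ∀ k, T2Space (Chain D k)] :
    Continuous fun p : C.real × D.real => F.real₂ p.1 p.2 := by
  have h1 : ∀ k, CompactSpace (C.nerve.obj (op (SimplexCategory.mk k))) := hC
  have h2 : ∀ k, T2Space (C.nerve.obj (op (SimplexCategory.mk k))) := hC'
  have h3 : ∀ k, CompactSpace (D.nerve.obj (op (SimplexCategory.mk k))) := hD
  have h4 : ∀ k, T2Space (D.nerve.obj (op (SimplexCategory.mk k))) := hD'
  refine Realization.continuous_of_prod fun r => ?_
  have h : ∀ p : (Chain C r × Chain D r) × stdSimplex ℝ (Fin (r + 1)),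
      F.real₂ (TopCategory.pt p.1.1 p.2) (TopCategory.pt p.1.2 p.2) =
        TopCategory.pt (F.mapChain (p.1.1.prod p.1.2)) p.2 := fun p => F.real₂_pt _ _ _
  change Continuous fun p : (Chain C r × Chain D r) × stdSimplex ℝ (Fin (r + 1)) =>
    F.real₂ (TopCategory.pt p.1.1 p.2) (TopCategory.pt p.1.2 p.2)
  simp only [h]
  exact (TopCategory.continuous_pt r).comp ((F.continuous_mapChain.comp
    (Chain.continuous_prod.comp continuous_fst)).prodMk continuous_snd)

/-! ### Compactness of unitary groups and of representation spaces -/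

instance compactSpace_U (n : ℕ) : CompactSpace (U n) := by
  refine isCompact_iff_compactSpace.1 ?_
  have hK : IsCompact (Set.univ.pi fun _ : Fin n => Set.univ.pi fun _ : Fin n =>
      Metric.closedBall (0 : ℂ) 1) :=
    isCompact_univ_pi fun _ => isCompact_univ_pi fun _ => isCompact_closedBall 0 1
  refine IsCompact.of_isClosed_subset hK ?_ ?_
  · have h : (Matrix.unitaryGroup (Fin n) ℂ : Set (Matrix (Fin n) (Fin n) ℂ)) =
        {A | A * star A = 1} := by
      ext A
      exact Matrix.mem_unitaryGroup_iff
    rw [h]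
    exact isClosed_eq (continuous_id.mul continuous_star) continuous_const
  · intro A hA i _ j _
    simpa using entry_norm_bound_of_unitary hA i j

/-- The simplex of the nerve of the translation category with the given vertices. -/
def translationChain {n k : ℕ} (A : Fin (k + 1) → U n) : Chain (translation n) k where
  obj := A
  mor i j _ := (A j, A i)
  dom_mor _ _ _ := rfl
  cod_mor _ _ _ := rfl
  mor_self _ := rfl
  mor_comp _ _ _ _ _ := rfl

theorem translationChain_obj {n k : ℕ} (x : Chain (translation n) k) :
    translationChain x.obj = x :=
  Chain.ext_mor fun i j h => Prod.ext (x.cod_mor i j h).symm (x.dom_mor i j h).symm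

theorem continuous_translationChain {n k : ℕ} :
    Continuous (translationChain : (Fin (k + 1) → U n) → Chain (translation n) k) :=
  Chain.continuous_rng fun i j _ => (continuous_apply j).prodMk (continuous_apply i)

instance (n k : ℕ) : CompactSpace (Chain (translation n) k) :=
  Function.Surjective.compactSpace continuous_translationChain
    fun x => ⟨x.obj, translationChain_obj x⟩

variable {G : Type u} [Group G]

/-- Multiplicativity is a family of closed conditions on `∏ U(n)`, which is compact by Tychonoff. -/
instance compactSpace_repSpace (n : ℕ) : CompactSpace (RepSpace G n) := by
  have hi : Topology.IsInducing fun ρ : RepSpace G n => (ρ : G → U n) := ⟨rfl⟩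
  have h : Set.range (fun ρ : RepSpace G n => (ρ : G → U n)) =
      ⋂ g : G, ⋂ h : G, {f | f (g * h) = f g * f h} := by
    ext f
    simp only [Set.mem_range, Set.mem_iInter, Set.mem_ofPred_eq]
    constructor
    · rintro ⟨ρ, rfl⟩ g h
      exact map_mul ρ g h
    · exact fun hf => ⟨MonoidHom.mk' f hf, rfl⟩
  have hc : IsClosed (Set.range (fun ρ : RepSpace G n => (ρ : G → U n))) := by
    rw [h]
    exact isClosed_iInter fun g => isClosed_iInter fun h =>
      isClosed_eq (by fun_prop) (by fun_prop)
  rw [← isCompact_univ_iff, hi.isCompact_iff, Set.image_univ]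
  exact hc.isCompact

instance t2Space_repSpace (n : ℕ) : T2Space (RepSpace G n) :=
  T2Space.of_injective_continuous (f := fun ρ : RepSpace G n => (ρ : G → U n))
    DFunLike.coe_injective continuous_induced_dom

/-! ### The homotopy orbit spaces -/

theorem rightMul_mul {n : ℕ} (g h : U n) (e : EU n) :
    (rightMul h).real ((rightMul g).real e) = (rightMul (g * h)).real e := by
  obtain ⟨k, x, t, rfl⟩ := TopCategory.exists_rep e
  rw [TopFunctor.real_pt, TopFunctor.real_pt, TopFunctor.real_pt]
  congr 1
  exact Chain.ext_mor fun i j hij => Prod.ext (mul_assoc _ _ _) (mul_assoc _ _ _)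

theorem OrbitRel.equivalence (G : Type u) [Group G] (n : ℕ) : Equivalence (OrbitRel G n) where
  refl := OrbitRel.refl
  symm := by
    rintro ⟨e, ρ⟩ _ ⟨g, rfl⟩
    refine ⟨g⁻¹, ?_⟩
    rw [rightMul_mul, mul_inv_cancel, rightMul_one, RepSpace.conj_conj, inv_inv, mul_inv_cancel,
      RepSpace.conj_one]
  trans := by
    rintro ⟨e, ρ⟩ _ _ ⟨g, rfl⟩ ⟨h, rfl⟩
    refine ⟨g * h, ?_⟩
    rw [rightMul_mul, RepSpace.conj_conj, mul_inv_rev]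

theorem RepSpace.continuous_conj_right {n : ℕ} (A : U n) :
    Continuous (RepSpace.conj A : RepSpace G n → RepSpace G n) :=
  RepSpace.continuous_rng fun g =>
    (continuous_const.mul (RepSpace.continuous_eval g)).mul continuous_const

/-- The right action of `g` on `EU(n) × Hom(G, U(n))`. -/
def orbitAct {n : ℕ} (g : U n) (p : EU n × RepSpace G n) : EU n × RepSpace G n :=
  ((rightMul g).real p.1, RepSpace.conj g⁻¹ p.2)

theorem continuous_orbitAct {n : ℕ} (g : U n) :
    Continuous (orbitAct g : EU n × RepSpace G n → EU n × RepSpace G n) :=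
  (rightMul g).continuous_real.prodMap (RepSpace.continuous_conj_right g⁻¹)

theorem OrbitRel.mk_eq_iff {n : ℕ} (p p' : EU n × RepSpace G n) :
    Quot.mk (OrbitRel G n) p = Quot.mk (OrbitRel G n) p' ↔ ∃ g, p' = orbitAct g p :=
  (OrbitRel.equivalence G n).quot_mk_eq_iff p p'

/-- The saturation of an open set is a union of translates, so only continuity of each single `g` is
used, not joint continuity of the action. Openness matters because products of open quotient maps
are quotient maps. -/
theorem OrbitRel.isOpenMap_mk (G : Type u) [Group G] (n : ℕ) :
    IsOpenMap (Quot.mk (OrbitRel G n)) := by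
  intro V hV
  refine isOpen_coinduced.2 ?_
  have h : Quot.mk (OrbitRel G n) ⁻¹' (Quot.mk (OrbitRel G n) '' V) =
      ⋃ g : U n, orbitAct g ⁻¹' V := by
    ext p
    simp only [Set.mem_preimage, Set.mem_image, Set.mem_iUnion]
    constructor
    · rintro ⟨p', hp', h⟩
      obtain ⟨g, hg⟩ := (OrbitRel.mk_eq_iff p p').1 h.symm
      exact ⟨g, hg ▸ hp'⟩
    · rintro ⟨g, hg⟩
      exact ⟨_, hg, ((OrbitRel.mk_eq_iff p _).2 ⟨g, rfl⟩).symm⟩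
  rw [h]
  exact isOpen_iUnion fun g => hV.preimage (continuous_orbitAct g)

theorem HomotopyOrbit.isOpenQuotientMap_mk (G : Type u) [Group G] (n : ℕ) :
    IsOpenQuotientMap (Quot.mk (OrbitRel G n) : EU n × RepSpace G n → HomotopyOrbit G n) :=
  ⟨Quot.mk_surjective, continuous_quot_mk, OrbitRel.isOpenMap_mk G n⟩

theorem RepHU.continuous_mk (n : ℕ) :
    Continuous fun p : EU n × RepSpace G n => (RepHU.mk p.1 p.2 : RepHU G) :=
  (continuous_sigmaMk (σ := HomotopyOrbit G) (i := n)).comp continuous_quot_mk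

theorem RepHU.continuous_mul : Continuous fun p : RepHU G × RepHU G => p.1 * p.2 := by
  refine continuous_sigma_prod (A := HomotopyOrbit G) (B := HomotopyOrbit G) fun n m => ?_
  refine ((HomotopyOrbit.isOpenQuotientMap_mk G n).prodMap
    (HomotopyOrbit.isOpenQuotientMap_mk G m)).isQuotientMap.continuous_iff.2 ?_
  have h1 : Continuous fun p : (EU n × RepSpace G n) × (EU m × RepSpace G m) =>
      (translationSum n m).real₂ p.1.1 p.2.1 :=
    (translationSum n m).continuous_real₂.comp
      ((continuous_fst.comp continuous_fst).prodMk (continuous_fst.comp continuous_snd))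
  have h2 : Continuous fun p : (EU n × RepSpace G n) × (EU m × RepSpace G m) =>
      RepSpace.sum p.1.2 p.2.2 := RepSpace.continuous_sum.comp
      ((continuous_snd.comp continuous_fst).prodMk (continuous_snd.comp continuous_snd))
  exact (RepHU.continuous_mk (n + m)).comp (h1.prodMk h2)

/-! ### Continuity of `α` -/

theorem continuous_orbitFunctor_mapChain (n k : ℕ) :
    Continuous fun p : Chain (translation n) k × RepSpace G n =>
      (orbitFunctor p.2).mapChain p.1 := by
  refine Chain.continuous_rng fun i j h => ?_
  have h1 : Continuous fun p : Chain (translation n) k × RepSpace G n => (p.1.mor i j h).1 :=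
    continuous_fst.comp ((Chain.continuous_mor i j h).comp continuous_fst)
  have h2 : Continuous fun p : Chain (translation n) k × RepSpace G n => (p.1.mor i j h).2 :=
    continuous_snd.comp ((Chain.continuous_mor i j h).comp continuous_fst)
  have h3 : Continuous fun p : Chain (translation n) k × RepSpace G n =>
      RepSpace.conj (p.1.mor i j h).2 p.2 := RepSpace.continuous_rng fun g =>
    (h2.mul ((RepSpace.continuous_eval g).comp continuous_snd)).mul h2.inv
  exact continuous_repMor_mk (h1.mul h2.inv) h3

theorem continuous_orbitFunctor_pt (n k : ℕ) :
    Continuous fun p : (Chain (translation n) k × stdSimplex ℝ (Fin (k + 1))) × RepSpace G n =>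
      (orbitFunctor p.2).real (TopCategory.pt p.1.1 p.1.2) :=
  (TopCategory.continuous_pt k).comp (((continuous_orbitFunctor_mapChain n k).comp
    ((continuous_fst.comp continuous_fst).prodMk continuous_snd)).prodMk
      (continuous_snd.comp continuous_fst))

/-- The functor itself varies with `ρ`, so joint continuity is needed; it reduces to cells because
`Hom(G, U(n))` is locally compact. -/
theorem continuous_orbitFunctor_real (n : ℕ) :
    Continuous fun p : EU n × RepSpace G n => (orbitFunctor p.2).real p.1 :=
  Realization.continuous_of_prod_left (f := fun p : EU n × RepSpace G n =>
    (orbitFunctor p.2).real p.1) fun k => continuous_orbitFunctor_pt n k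

theorem continuous_alpha : Continuous (alpha G) :=
  continuous_sigma fun n =>
    (HomotopyOrbit.isOpenQuotientMap_mk G n).isQuotientMap.continuous_iff.2
      (continuous_orbitFunctor_real n)

/-! ### The inverse of `α` -/

/-- The unitary matrix of a morphism of `R(G)` in dimension `n`. -/
def unitaryPart (n : ℕ) (f : RepMor G) : U n :=
  -- The default value in other dimensions makes the function total; it stays continuous because the
  -- summands are open.
  if h : f.1 = n then castU h f.2.1 else 1

/-- The representation of dimension `n` given by an object of `R(G)` in dimension `n`. -/
def repPart (n : ℕ) (x : RepOb G) : RepSpace G n :=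
  if h : x.1 = n then h ▸ x.2 else (1 : G →* U n)

@[simp]
theorem unitaryPart_mk {n : ℕ} (A : U n) (ρ : RepSpace G n) :
    unitaryPart n (⟨n, A, ρ⟩ : RepMor G) = A := by
  simp [unitaryPart, castU]

@[simp]
theorem repPart_mk {n : ℕ} (ρ : RepSpace G n) : repPart n (⟨n, ρ⟩ : RepOb G) = ρ := by
  simp [repPart]

theorem continuous_unitaryPart (n : ℕ) : Continuous (unitaryPart n : RepMor G → U n) := by
  refine continuous_sigma fun m => ?_
  by_cases h : m = n
  · subst h
    have e : (fun p => unitaryPart m (⟨m, p⟩ : RepMor G)) = Prod.fst :=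
      funext fun p => unitaryPart_mk p.1 p.2
    exact e ▸ continuous_fst
  · have e : (fun p => unitaryPart n (⟨m, p⟩ : RepMor G)) = fun _ => 1 :=
      funext fun p => dif_neg h
    exact e ▸ continuous_const

theorem continuous_repPart (n : ℕ) : Continuous (repPart n : RepOb G → RepSpace G n) := by
  refine continuous_sigma fun m => ?_
  by_cases h : m = n
  · subst h
    have e : (fun ρ => repPart m (⟨m, ρ⟩ : RepOb G)) = id := funext fun ρ => repPart_mk ρ
    exact e ▸ continuous_id
  · have e : (fun ρ => repPart n (⟨m, ρ⟩ : RepOb G)) = fun _ => (1 : G →* U n) :=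
      funext fun ρ => dif_neg h
    exact e ▸ continuous_const

/-- The matrix of `g` is that of `g ∘ f` times the inverse of that of `f`. Hence a simplex is
determined by its first object and its arrows out of vertex `0`. -/
theorem eq_of_composable {f g : RepMor G} {n : ℕ} {ρ : RepSpace G n}
    (hf : (repCategory G).dom f = ⟨n, ρ⟩) (hg : (repCategory G).dom g = (repCategory G).cod f) :
    g = ⟨n, unitaryPart n ((repCategory G).comp g f hg) * (unitaryPart n f)⁻¹,
      RepSpace.conj (unitaryPart n f) ρ⟩ := by
  obtain ⟨m, A, φ⟩ := f
  obtain rfl : m = n := congrArg Sigma.fst hf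
  obtain rfl : φ = ρ := eq_of_heq (Sigma.mk.inj hf).2
  obtain ⟨l, B, ψ⟩ := g
  obtain rfl : l = m := congrArg Sigma.fst hg
  obtain rfl : ψ = RepSpace.conj A φ := eq_of_heq (Sigma.mk.inj hg).2
  simp only [unitaryPart_mk, castU, mul_inv_cancel_right]

/-- The vertices of the simplex of the translation category attached to a simplex of `R(G)` whose
first vertex has dimension `n`. -/
def startChain (n : ℕ) {k : ℕ} (x : Chain (repCategory G) k) : Chain (translation n) k :=
  translationChain fun i => unitaryPart n (x.mor 0 i (Fin.zero_le i))

/-- Every simplex of `R(G)` comes from a translation category, with `Aᵢ` the matrix of the arrow `0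
→ i`; this is the surjectivity of `α`. -/
theorem mapChain_startChain {k : ℕ} (x : Chain (repCategory G) k) :
    (orbitFunctor (x.obj 0).2).mapChain (startChain (x.obj 0).1 x) = x := by
  refine Chain.ext_mor fun i j hij => ?_
  have h := eq_of_composable (x.dom_mor 0 i (Fin.zero_le i))
    ((x.dom_mor i j hij).trans (x.cod_mor 0 i (Fin.zero_le i)).symm)
  rw [x.mor_comp] at h
  exact h.symm

/-- The inverse of `α` on simplices with first vertex in dimension `n`. -/
def unorbitAt (n : ℕ) {k : ℕ} (x : Chain (repCategory G) k) (t : stdSimplex ℝ (Fin (k + 1))) :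
    RepHU G :=
  RepHU.mk (TopCategory.pt (startChain n x) t) (repPart n (x.obj 0))

/-- Reading off the arrows out of vertex `0` yields `(Aᵢ A₀⁻¹)` and `A₀ ρ A₀⁻¹`, the translate of
`((Aᵢ), ρ)` by `g = A₀⁻¹`, so the orbit is unchanged. This gives both that `unorbit` respects gluing
and that it inverts `α`. -/
theorem unorbitAt_mapChain {n k : ℕ} (y : Chain (translation n) k) (ρ : RepSpace G n)
    (t : stdSimplex ℝ (Fin (k + 1))) :
    unorbitAt n ((orbitFunctor ρ).mapChain y) t = RepHU.mk (TopCategory.pt y t) ρ := by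
  have h1 : startChain n ((orbitFunctor ρ).mapChain y) =
      (rightMul (y.obj 0)⁻¹).mapChain y := by
    refine Chain.ext_mor fun i j hij => ?_
    have h : ∀ i, unitaryPart n (((orbitFunctor ρ).mapChain y).mor 0 i (Fin.zero_le i)) =
        y.obj i * (y.obj 0)⁻¹ := by
      intro i
      refine (unitaryPart_mk _ _).trans ?_
      rw [← y.cod_mor 0 i (Fin.zero_le i), ← y.dom_mor 0 i (Fin.zero_le i)]
    refine Prod.ext ((h j).trans ?_) ((h i).trans ?_)
    · rw [← y.cod_mor i j hij]; rfl
    · rw [← y.dom_mor i j hij]; rfl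
  have h2 : repPart n (((orbitFunctor ρ).mapChain y).obj 0) = RepSpace.conj (y.obj 0)⁻¹⁻¹ ρ := by
    rw [inv_inv]
    exact repPart_mk _
  unfold unorbitAt
  rw [h1, h2, ← TopFunctor.real_pt]
  exact congrArg (Sigma.mk n) (Quot.sound ⟨(y.obj 0)⁻¹, rfl⟩).symm

/-- The map `|R(G)| → Rep(G)_{hU}` inverse to `α`. -/
def unorbit (p : (repCategory G).real) : RepHU G :=
  Quot.lift (fun q : Cells (repCategory G).nerve =>
    unorbitAt (Chain.obj (C := repCategory G) (k := q.1) q.2.1 0).1 (k := q.1) q.2.1 q.2.2) (by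
    rintro _ _ ⟨θ, x, t⟩
    change Chain (repCategory G) _ at x
    -- An operator `θ` may change the initial vertex and hence the normal form, but not the orbit.
    -- Lifting `x` to a translation category reduces the claim to gluing in `EU(n)` with the same
    -- `ρ`.
    obtain ⟨n, y, ρ, rfl⟩ : ∃ (n : ℕ) (y : Chain (translation n) _) (ρ : RepSpace G n),
      (orbitFunctor ρ).mapChain y = x := ⟨_, _, _, mapChain_startChain x⟩
    exact (unorbitAt_mapChain (y.precomp θ.toOrderHom) ρ t).trans
      ((congrArg (RepHU.mk · ρ) (TopCategory.pt_glue θ.toOrderHom y t)).symm.trans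
        (unorbitAt_mapChain y ρ (stdSimplex.map θ.toOrderHom t)).symm)) p

theorem unorbit_pt {k : ℕ} (x : Chain (repCategory G) k) (t : stdSimplex ℝ (Fin (k + 1))) :
    unorbit (TopCategory.pt x t) = unorbitAt (x.obj 0).1 x t := rfl

theorem alpha_unorbit (p : (repCategory G).real) : alpha G (unorbit p) = p := by
  obtain ⟨k, x, t, rfl⟩ := TopCategory.exists_rep p
  obtain ⟨n, y, ρ, rfl⟩ : ∃ (n : ℕ) (y : Chain (translation n) k) (ρ : RepSpace G n),
    (orbitFunctor ρ).mapChain y = x := ⟨_, _, _, mapChain_startChain x⟩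
  rw [unorbit_pt]
  exact (congrArg (alpha G) (unorbitAt_mapChain y ρ t)).trans (alpha_mk y t ρ)

theorem unorbit_alpha (p : RepHU G) : unorbit (alpha G p) = p := by
  obtain ⟨n, e, ρ, rfl⟩ := p.exists_rep
  obtain ⟨k, y, t, rfl⟩ := TopCategory.exists_rep e
  rw [alpha_mk, unorbit_pt]
  exact unorbitAt_mapChain y ρ t

theorem continuous_unorbitAt (n k : ℕ) :
    Continuous fun p : Chain (repCategory G) k × stdSimplex ℝ (Fin (k + 1)) =>
      unorbitAt n p.1 p.2 := by
  have h1 : Continuous fun x : Chain (repCategory G) k => startChain n x :=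
    continuous_translationChain.comp (continuous_pi fun i =>
      (continuous_unitaryPart n).comp (Chain.continuous_mor 0 i (Fin.zero_le i)))
  have h2 : Continuous fun x : Chain (repCategory G) k => repPart n (x.obj 0) :=
    (continuous_repPart n).comp (Chain.continuous_obj 0)
  exact (RepHU.continuous_mk n).comp (((TopCategory.continuous_pt k).comp
    ((h1.comp continuous_fst).prodMk continuous_snd)).prodMk (h2.comp continuous_fst))

theorem continuous_unorbit : Continuous (unorbit : (repCategory G).real → RepHU G) := by
  refine Realization.continuous_iff.2 fun k => ?_
  change Continuous fun p : Chain (repCategory G) k × stdSimplex ℝ (Fin (k + 1)) =>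
    unorbitAt (p.1.obj 0).1 p.1 p.2
  have hdim : Continuous fun p : Chain (repCategory G) k × stdSimplex ℝ (Fin (k + 1)) =>
      (p.1.obj 0).1 :=
    (continuous_sigma fun n => continuous_const :
      Continuous fun x : RepOb G => x.1).comp ((Chain.continuous_obj 0).comp continuous_fst)
  -- The dimension of the initial vertex is locally constant, so near `p` the map agrees with
  -- `unorbitAt` for one fixed dimension.
  refine continuous_iff_continuousAt.2 fun p => ?_
  refine (continuous_unorbitAt (p.1.obj 0).1 k).continuousAt.congr ?_
  filter_upwards [hdim.continuousAt.preimage_mem_nhds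
    ((isOpen_discrete {(p.1.obj 0).1}).mem_nhds rfl)] with p' hp'
  rw [show (p'.1.obj 0).1 = (p.1.obj 0).1 from hp']

/-! ### Multiplicativity of `α` -/

theorem alpha_mul (p q : RepHU G) : alpha G (p * q) = alpha G p * alpha G q := by
  obtain ⟨n, e, ρ, rfl⟩ := p.exists_rep
  obtain ⟨m, e', ρ', rfl⟩ := q.exists_rep
  obtain ⟨k, x, y, t, rfl, rfl⟩ := TopCategory.exists_common_rep e e'
  rw [RepHU.mk_mul_mk, TopFunctor.real₂_pt, alpha_mk, alpha_mk, alpha_mk]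
  refine Eq.trans ?_ ((repSum G).real₂_pt _ _ t).symm
  congr 1
  refine Chain.ext_mor fun i j hij => ?_
  have h1 : ∀ (A A' : U n) (B B' : U m), blockSum A B * (blockSum A' B')⁻¹ =
      blockSum (A * A'⁻¹) (B * B'⁻¹) := fun A A' B B' => by rw [← blockSum_inv, ← blockSum_mul]
  change (⟨n + m, blockSum _ _ * (blockSum _ _)⁻¹,
    RepSpace.conj (blockSum _ _) (RepSpace.sum ρ ρ')⟩ : RepMor G) = ⟨n + m, _, _⟩
  rw [h1, RepSpace.conj_sum]
  rfl

/-- The isomorphism of topological monoids `α : Rep(G)_{hU} → |R(G)|`. -/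
def alphaEquiv (G : Type u) [Group G] : RepHU G ≃ₜ* (repCategory G).real where
  toFun := alpha G
  invFun := unorbit
  left_inv := unorbit_alpha
  right_inv := alpha_unorbit
  map_mul' := alpha_mul
  continuous_toFun := continuous_alpha
  continuous_invFun := continuous_unorbit

/-- The simplex spaces of `R(G)` are infinite disjoint unions, hence not compact, and
`TopFunctor.continuous_real₂` does not apply to `repSum`. Continuity is carried over from
`Rep(G)_{hU}` by the homeomorphism `α`. -/
theorem continuousMul_repReal (G : Type u) [Group G] : ContinuousMul (repCategory G).real where
  continuous_mul := by
    have h : (fun p : (repCategory G).real × (repCategory G).real => p.1 * p.2) =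
        fun p => alpha G (unorbit p.1 * unorbit p.2) := by
      funext p
      rw [alpha_mul, alpha_unorbit, alpha_unorbit]
    rw [h]
    exact continuous_alpha.comp (RepHU.continuous_mul.comp
      (continuous_unorbit.prodMap continuous_unorbit))

end

end DefK

theorem proposition2p3 (G : Type*) [Group G] :
    ContinuousMul (DefK.RepHU G) ∧ ContinuousMul (DefK.repCategory G).real ∧
      ∃ Φ : DefK.RepHU G ≃ₜ* (DefK.repCategory G).real, ∀ p, Φ p = DefK.alpha G p :=
  ⟨⟨DefK.RepHU.continuous_mul⟩, DefK.continuousMul_repReal G, DefK.alphaEquiv G, fun _ => rfl⟩
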